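/- Game I (the sequential Showcase Showdown game with full information). Players $A_1,\dots,A_n$ play one after the other. In his turn a player starts from the total $0$ and adds to it independent random numbers, uniform on $[0,1]$, until he decides to stop or his total exceeds $1$; his score is his total if it is at most $1$ when he stops, and $0$ if it exceeded $1$. A strategy of a player is a (measurable) stopping rule that may depend on the scores of all the earlier players and on his own past spins. A player wins if his score is positive and greater than the score of every other player; if all the scores are $0$ there is a draw. A strategy of a player is optimal, given the earlier scores and the strategies of the later players, if it maximizes his winning probability among all his strategies. The threshold strategy with greed threshold $\kappa$ consists in continuing to play until the total is greater than $\kappa$ (or exceeds $1$). Let $p(x)=1+e^x(x-1)$. For every $r\ge 1$ the equation $$p(x)^{r-1}=\int_x^1 p(t)^{r-1}\,dt$$ has exactly one root in $[0,1]$ (with the convention $0^0=1$ when $r=1$); denote it by $\theta_r$. **Proposition.** Suppose that $r\ge 1$ players are still to play and that $M_r\in[0,1]$ is the maximum score of those who have already played ($M_r=0$ if nobody has played yet). Suppose that every player after the next one plays optimally, whatever scores the players before him obtain from now on. Then $\max\{\theta_r,M_r\}$ is an optimal greed threshold for the next player: the corresponding threshold strategy is optimal. If $M_r<1$, it is the only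 optimal greed threshold in $[0,1]$. In particular, if at every stage the player whose turn it is uses the threshold $\max\{\theta_r,M_r\}$ given by the current values of $r$ and $M_r$, then every player plays optimally at every stage, whatever the earlier scores are. -/

import Mathlib

open MeasureTheory Set

noncomputable section

namespace Showcase

/-- A strategy of player `i` (players are numbered `0, 1, 2, …` in order of play): a stopping rule
that may depend on the scores of the players `0, …, i - 1` and on the player's own past spins.
`halts h k v` means: the earlier scores being `h`, after `k` spins with results `v` the player stops
(if his total has not exceeded `1`). -/
structure Strategy (i : ℕ) where
  halts : (Fin i → ℝ) → (k : ℕ) → (Fin k → unitInterval) → Prop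
  measurable_halts : ∀ k : ℕ,
    MeasurableSet {q : (Fin i → ℝ) × (Fin k → unitInterval) | halts q.1 k q.2}

/-- A strategy for each player. -/
abbrev Profile : Type := (i : ℕ) → Strategy i

/-- The greed threshold strategy: keep playing until the total is greater than `κ h`, where `h`
lists the scores of the earlier players. -/
def Strategy.threshold {i : ℕ} (κ : (Fin i → ℝ) → ℝ) (hκ : Measurable κ) : Strategy i where
  halts h _ v := κ h < ∑ j, (v j : ℝ)
  measurable_halts k := by
    have h1 : Measurable fun q : (Fin i → ℝ) × (Fin k → unitInterval) => κ q.1 :=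
      hκ.comp measurable_fst
    have h2 : Measurable fun q : (Fin i → ℝ) × (Fin k → unitInterval) => ∑ j, (q.2 j : ℝ) := by
      fun_prop
    exact measurableSet_lt h1 h2

/-- The total after `k` spins. -/
def total (z : ℕ → unitInterval) (k : ℕ) : ℝ := ∑ j ∈ Finset.range k, (z j : ℝ)

open Classical in
/-- The score of a player with stopping rule `halts` whose successive spins are `z`: his turn ends
at the first `k` at which his total exceeds `1` or he stops; the score is his total then if this is
at most `1`, and `0` otherwise. (A turn that never ends, which has probability zero, scores `0`.) -/
def turnScore (halts : (k : ℕ) → (Fin k → unitInterval) → Prop) (z : ℕ → unitInterval) : ℝ :=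
  if h : ∃ k : ℕ, 1 < total z k ∨ halts k (fun j => z j) then
    if total z (Nat.find h) ≤ 1 then total z (Nat.find h) else 0
  else 0

/-- Independent spins, uniform on `[0,1]`: `ω i k` is the `k`-th spin of player `i`. -/
def spinMeasure : Measure (ℕ → ℕ → unitInterval) :=
  Measure.infinitePi fun _ : ℕ => Measure.infinitePi fun _ : ℕ => (volume : Measure unitInterval)

/-- The first `i` coordinates of `s`: the scores of the players `0, …, i - 1`. -/
def history (s : ℕ → ℝ) (i : ℕ) : Fin i → ℝ := fun j => s j

/-- Starting from the scores `s` (of which the coordinates `< i` matter), the players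
`i, i + 1, …, i + m - 1` play in turn according to `σ`, with spins `ω`, and their scores are
recorded one after the other. -/
def play (σ : Profile) (ω : ℕ → ℕ → unitInterval) : (m i : ℕ) → (ℕ → ℝ) → (ℕ → ℝ)
  | 0, _, s => s
  | m + 1, i, s =>
      play σ ω m (i + 1) (Function.update s i (turnScore ((σ i).halts (history s i)) (ω i)))

/-- Player `i` wins the `n`-player game with final scores `s`: his score is positive (if all scores
are `0` there is a draw) and greater than the score of every other player. -/
def Wins (n i : ℕ) (s : ℕ → ℝ) : Prop := 0 < s i ∧ ∀ j < n, j ≠ i → s j < s i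

/-- The probability that player `i` wins the `n`-player game when it is his turn, the scores of the
earlier players are given by `s`, and the players `i, …, n - 1` follow `σ`. -/
def winProb (n : ℕ) (σ : Profile) (i : ℕ) (s : ℕ → ℝ) : ENNReal :=
  spinMeasure {ω | Wins n i (play σ ω (n - i) i s)}

/-- After the earlier scores `s`, the strategy of player `i` in `σ` maximizes his own winning
probability among all his strategies, the later players following `σ`. -/
def OptimalAt (n : ℕ) (σ : Profile) (i : ℕ) (s : ℕ → ℝ) : Prop :=
  ∀ τ : Strategy i, winProb n (Function.update σ i τ) i s ≤ winProb n σ i s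

/-- The first `i` coordinates of `s` are possible scores. -/
def ValidScores (i : ℕ) (s : ℕ → ℝ) : Prop := ∀ j < i, s j ∈ Icc (0 : ℝ) 1

/-- Whatever happens after the scores `s` of the players `0, …, i - 1` have been obtained, every
player `k` after player `i` plays optimally in `σ`, each knowing all the earlier scores. -/
def LaterOptimal (n : ℕ) (σ : Profile) (i : ℕ) (s : ℕ → ℝ) : Prop :=
  ∀ k, i < k → k < n → ∀ s' : ℕ → ℝ, history s' i = history s i → ValidScores k s' →
    OptimalAt n σ k s'

/-- Using the greed threshold `κ` is optimal for player `i` after the earlier scores `s`, among all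
strategies, the later players following `σ`. -/
def IsOptimalThreshold (n : ℕ) (σ : Profile) (i : ℕ) (s : ℕ → ℝ) (κ : ℝ) : Prop :=
  OptimalAt n (Function.update σ i (Strategy.threshold (fun _ => κ) measurable_const)) i s

/-- The maximum of the scores obtained so far (`0` if nobody has played yet). -/
def maxScore {i : ℕ} (h : Fin i → ℝ) : ℝ := ⨆ j, h j

theorem measurable_maxScore {i : ℕ} : Measurable (maxScore : (Fin i → ℝ) → ℝ) :=
  Measurable.iSup fun j => measurable_pi_apply j

/-- The function `p(x) = 1 + e^x (x - 1)`. -/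
def p (x : ℝ) : ℝ := 1 + Real.exp x * (x - 1)

/-- `x` is a root in `[0,1]` of `p(x)^(r-1) = ∫_x^1 p(t)^(r-1) dt`. -/
def IsGreedRoot (r : ℕ) (x : ℝ) : Prop :=
  x ∈ Icc (0 : ℝ) 1 ∧ p x ^ (r - 1) = ∫ t in x..1, p t ^ (r - 1)

/-- In the `n`-player game every player `i` uses the greed threshold `max {θ r, M}`, where
`r = n - i` players, himself included, are still to play and `M` is the maximum score so far. -/
def thresholdProfile (n : ℕ) (θ : ℕ → ℝ) : Profile := fun i =>
  Strategy.threshold (fun h => max (θ (n - i)) (maxScore h))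
    (measurable_const.max measurable_maxScore)

end Showcase

end

open MeasureTheory Set

noncomputable section

namespace Showcase

/-! The proof is a backward induction in which each turn is an optimal stopping problem for one
player.

Suppose that `m` is the best earlier score and that `r` players follow the next one. If the later
players play optimally, a score `y > m` wins with probability `failProb θ r y`, the product of the
chances `p (max (θ j) y)` that each of them fails to beat `y` (`AllFail`, `allFail`,
`winProb_update`). The next player thus maximizes the mean of `G = payoff θ r m` at his final score.
The roots `θ j` increase with `j`, so above `κ = max (θ (r + 1)) m` the payoff is just `p ^ r`, and
the root equation says that `κ` is where stopping becomes strictly better than one more spin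
(`isThresholdPayoff`).

For such a payoff let `V = thresholdValue G κ`. It dominates `G` on `[0,1]`; one more spin leaves
its mean unchanged below `κ` and strictly lowers it above `κ`. Optional stopping gives an exact
balance for every strategy (`value_eq_add_loss`): `V 0` is the mean payoff, plus the loss `V - G`
from stopping too early, plus the loss from playing on too long. The threshold `κ` loses nothing,
hence is optimal. Conversely any optimal strategy, threshold or not, almost surely stops only above
`κ` and plays on only up to `κ`.

This last fact gives uniqueness of the threshold and also closes the induction. The same balance
with payoff `1` shows that an optimal player ends in `(κ, 1]` with probability `e^κ (1 - κ) = 1 - p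
κ`, so he fails to beat a positive score `x ≤ κ` with probability `p κ` (`measure_turnScore_lt`). -/

/-! ### Resampling one coordinate of an infinite product. -/

theorem measurePreserving_update_infinitePi {ι X : Type*} [DecidableEq ι] [MeasurableSpace X]
    (μ : ι → Measure X) [∀ i, IsProbabilityMeasure (μ i)] (k : ι) :
    MeasurePreserving (fun q : X × (ι → X) => Function.update q.2 k q.1)
      ((μ k).prod (Measure.infinitePi μ)) (Measure.infinitePi μ) := by
  have hm : Measurable fun q : X × (ι → X) => Function.update q.2 k q.1 :=
    measurable_update'.comp measurable_swap
  refine ⟨hm, Measure.eq_infinitePi μ fun s t ht => ?_⟩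
  have hset : MeasurableSet ((s : Set ι).pi t) :=
    MeasurableSet.pi s.countable_toSet fun i _ => ht i
  rw [Measure.map_apply hm hset]
  by_cases hk : k ∈ s
  · have : (fun q : X × (ι → X) => Function.update q.2 k q.1) ⁻¹' ((s : Set ι).pi t)
        = t k ×ˢ (((s.erase k : Finset ι) : Set ι).pi t) := by
      ext q
      simp only [mem_preimage, Set.mem_pi, Finset.mem_coe, mem_prod, Finset.mem_erase]
      constructor
      · intro h
        refine ⟨by simpa using h k hk, fun i hi => by simpa [hi.1] using h i hi.2⟩
      · rintro ⟨h1, h2⟩ i hi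
        by_cases hik : i = k
        · subst hik; simpa using h1
        · simpa [hik] using h2 i ⟨hik, hi⟩
    rw [this, Measure.prod_prod, Measure.infinitePi_pi μ fun i _ => ht i,
      Finset.mul_prod_erase s (fun i => μ i (t i)) hk]
  · have : (fun q : X × (ι → X) => Function.update q.2 k q.1) ⁻¹' ((s : Set ι).pi t)
        = univ ×ˢ ((s : Set ι).pi t) := by
      ext q
      simp only [mem_preimage, Set.mem_pi, Finset.mem_coe, mem_prod, mem_univ, true_and]
      refine forall₂_congr fun i hi => ?_
      have : i ≠ k := fun h => hk (h ▸ hi)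
      simp [this]
    rw [this, Measure.prod_prod, Measure.infinitePi_pi μ fun i _ => ht i]
    simp

/-- Fubini for a single coordinate. It is used for one spin within a turn and for the whole turn of
one player within the game. -/
theorem lintegral_infinitePi_update {ι X : Type*} [DecidableEq ι] [MeasurableSpace X]
    (μ : ι → Measure X) [∀ i, IsProbabilityMeasure (μ i)] (k : ι)
    {f : (ι → X) → ENNReal} (hf : Measurable f) :
    ∫⁻ z, f z ∂Measure.infinitePi μ
      = ∫⁻ u, ∫⁻ z, f (Function.update z k u) ∂Measure.infinitePi μ ∂μ k := by
  have h := measurePreserving_update_infinitePi μ k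
  rw [← h.lintegral_comp hf]
  exact lintegral_prod _ (hf.comp h.measurable).aemeasurable

theorem lintegral_infinitePi_update' {ι X : Type*} [DecidableEq ι] [MeasurableSpace X]
    (μ : ι → Measure X) [∀ i, IsProbabilityMeasure (μ i)] (k : ι)
    {f : (ι → X) → ENNReal} (hf : Measurable f) :
    ∫⁻ z, f z ∂Measure.infinitePi μ
      = ∫⁻ z, ∫⁻ u, f (Function.update z k u) ∂μ k ∂Measure.infinitePi μ := by
  have h := measurePreserving_update_infinitePi μ k
  rw [← h.lintegral_comp hf]
  exact lintegral_prod_symm _ (hf.comp h.measurable).aemeasurable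

/-! ### The events and the score of a single turn. -/

/-- The law of the successive spins of one player. -/
def turnMeasure : Measure (ℕ → unitInterval) :=
  Measure.infinitePi fun _ : ℕ => (volume : Measure unitInterval)

instance : IsProbabilityMeasure turnMeasure := by unfold turnMeasure; infer_instance

instance : IsProbabilityMeasure spinMeasure := by unfold spinMeasure; infer_instance

/-- A stopping rule for a single turn. -/
abbrev Rule : Type := (k : ℕ) → (Fin k → unitInterval) → Prop

/-- The turn has not ended before the `k`-th spin. -/
def stillIn (halts : Rule) (k : ℕ) : Set (ℕ → unitInterval) :=
  {z | ∀ j < k, total z j ≤ 1 ∧ ¬ halts j (fun l => z l)}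

/-- The player stops after `k` spins, without having exceeded `1`. -/
def stopsAt (halts : Rule) (k : ℕ) : Set (ℕ → unitInterval) :=
  {z | z ∈ stillIn halts k ∧ total z k ≤ 1 ∧ halts k (fun l => z l)}

@[fun_prop]
theorem measurable_total (k : ℕ) : Measurable fun z => total z k := by
  unfold total
  fun_prop

theorem total_nonneg (z : ℕ → unitInterval) (k : ℕ) : 0 ≤ total z k :=
  Finset.sum_nonneg fun j _ => (z j).2.1

theorem total_succ (z : ℕ → unitInterval) (k : ℕ) : total z (k + 1) = total z k + z k :=
  Finset.sum_range_succ _ _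

@[simp] theorem total_zero (z : ℕ → unitInterval) : total z 0 = 0 := rfl

theorem total_update {k l : ℕ} (h : k ≤ l) (z : ℕ → unitInterval) (u : unitInterval) :
    total (Function.update z l u) k = total z k := by
  refine Finset.sum_congr rfl fun j hj => ?_
  have : j ≠ l := by have := Finset.mem_range.1 hj; omega
  simp [this]

theorem stillIn_succ (halts : Rule) (k : ℕ) :
    stillIn halts (k + 1) =
      {z | z ∈ stillIn halts k ∧ total z k ≤ 1 ∧ ¬ halts k (fun l => z l)} := by
  ext z
  simp only [stillIn, mem_ofPred_eq, Nat.lt_succ_iff_lt_or_eq]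
  constructor
  · exact fun h => ⟨fun j hj => h j (Or.inl hj), h k (Or.inr rfl)⟩
  · rintro ⟨h1, h2⟩ j (hj | rfl)
    exacts [h1 j hj, h2]

/-- The decision to take spin `k` rests on the spins before it only; this is the independence behind
the optional stopping identity. -/
theorem update_mem_stillIn (halts : Rule) (k : ℕ) (z : ℕ → unitInterval) (u : unitInterval) :
    Function.update z k u ∈ stillIn halts (k + 1) ↔ z ∈ stillIn halts (k + 1) := by
  refine forall₂_congr fun j hj => ?_
  rw [total_update (by omega)]
  have : (fun l : Fin j => Function.update z k u l) = fun l : Fin j => z l := by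
    funext l
    have : (l : ℕ) ≠ k := by omega
    simp [this]
  rw [this]

section
variable {X : Type*} [MeasurableSpace X] {halts : X → Rule}
  (hh : ∀ k, MeasurableSet {q : X × (Fin k → unitInterval) | halts q.1 k q.2})
include hh

theorem measurableSet_halts_joint (k : ℕ) :
    MeasurableSet {q : X × (ℕ → unitInterval) | halts q.1 k fun l => q.2 l} := by
  have : Measurable fun q : X × (ℕ → unitInterval) => (q.1, fun l : Fin k => q.2 l) := by
    fun_prop
  exact this (hh k)

theorem measurableSet_stillIn_joint (k : ℕ) :
    MeasurableSet {q : X × (ℕ → unitInterval) | q.2 ∈ stillIn (halts q.1) k} := by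
  induction k with
  | zero => simp [stillIn]
  | succ k ih =>
    simp only [stillIn_succ, mem_ofPred_eq]
    exact ih.inter ((measurableSet_le ((measurable_total k).comp measurable_snd)
      measurable_const).inter (measurableSet_halts_joint hh k).compl)

theorem measurableSet_stopsAt_joint (k : ℕ) :
    MeasurableSet {q : X × (ℕ → unitInterval) | q.2 ∈ stopsAt (halts q.1) k} :=
  (measurableSet_stillIn_joint hh k).inter ((measurableSet_le
    ((measurable_total k).comp measurable_snd) measurable_const).inter
      (measurableSet_halts_joint hh k))
end

theorem stopsAt_unique {halts : Rule} {k l : ℕ} {z : ℕ → unitInterval}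
    (hk : z ∈ stopsAt halts k) (hl : z ∈ stopsAt halts l) : k = l := by
  rcases lt_trichotomy k l with h | h | h
  · exact absurd hk.2.2 (hl.1 k h).2
  · exact h
  · exact absurd hl.2.2 (hk.1 l h).2

theorem turnScore_of_stopsAt {halts : Rule} {k : ℕ} {z : ℕ → unitInterval}
    (hz : z ∈ stopsAt halts k) : turnScore halts z = total z k := by
  classical
  have hex : ∃ k : ℕ, 1 < total z k ∨ halts k (fun j => z j) := ⟨k, Or.inr hz.2.2⟩
  have hfind : Nat.find hex = k := by
    rw [Nat.find_eq_iff]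
    refine ⟨Or.inr hz.2.2, fun n hn => ?_⟩
    have := hz.1 n hn
    rw [not_or]
    exact ⟨not_lt.2 this.1, this.2⟩
  unfold turnScore
  rw [dif_pos hex]
  have h2 : ∀ m, m = k → (if total z m ≤ 1 then total z m else 0) = total z k := by
    rintro m rfl
    rw [if_pos hz.2.1]
  exact h2 _ (by convert hfind)

theorem turnScore_of_not_stopsAt {halts : Rule} {z : ℕ → unitInterval}
    (hz : ∀ k, z ∉ stopsAt halts k) : turnScore halts z = 0 := by
  classical
  unfold turnScore
  split_ifs with hex hle
  · exfalso
    have hs := Nat.find_spec hex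
    refine hz (Nat.find hex) ⟨fun j hj => ?_, hle, hs.resolve_left (not_lt.2 hle)⟩
    have := Nat.find_min hex hj
    rw [not_or, not_lt] at this
    exact this
  · rfl
  · rfl

theorem turnScore_mem_Icc (halts : Rule) (z : ℕ → unitInterval) :
    turnScore halts z ∈ Icc (0 : ℝ) 1 := by
  by_cases h : ∃ k, z ∈ stopsAt halts k
  · obtain ⟨k, hk⟩ := h
    rw [turnScore_of_stopsAt hk]
    exact ⟨total_nonneg z k, hk.2.1⟩
  · push Not at h
    rw [turnScore_of_not_stopsAt h]
    simp

/-- The events `stopsAt halts k` are disjoint, and `f 0 = 0` discards the turns that end beyond `1`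
or never end. -/
theorem apply_turnScore_eq_tsum (halts : Rule) {f : ℝ → ENNReal} (hf : f 0 = 0)
    (z : ℕ → unitInterval) :
    f (turnScore halts z) = ∑' k, (stopsAt halts k).indicator (fun z => f (total z k)) z := by
  by_cases h : ∃ k, z ∈ stopsAt halts k
  · obtain ⟨k, hk⟩ := h
    rw [turnScore_of_stopsAt hk, tsum_eq_single k]
    · rw [indicator_of_mem hk]
    · intro l hl
      exact indicator_of_notMem (fun hl' => hl (stopsAt_unique hl' hk)) _
  · push Not at h
    rw [turnScore_of_not_stopsAt h, hf, eq_comm, ENNReal.tsum_eq_zero]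
    exact fun k => indicator_of_notMem (h k) _

/-- Joint measurability is needed because the rule of a later player depends on random earlier
scores. -/
theorem measurable_turnScore_joint {X : Type*} [MeasurableSpace X] {halts : X → Rule}
    (hh : ∀ k, MeasurableSet {q : X × (Fin k → unitInterval) | halts q.1 k q.2}) :
    Measurable fun q : X × (ℕ → unitInterval) => turnScore (halts q.1) q.2 := by
  have h : (fun q : X × (ℕ → unitInterval) => turnScore (halts q.1) q.2) = fun q =>
      (∑' k, {q : X × (ℕ → unitInterval) | q.2 ∈ stopsAt (halts q.1) k}.indicator
        (fun q => ENNReal.ofReal (total q.2 k)) q).toReal := by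
    funext q
    have := apply_turnScore_eq_tsum (halts q.1) ENNReal.ofReal_zero q.2
    rw [← ENNReal.toReal_ofReal (turnScore_mem_Icc (halts q.1) q.2).1, this]
    rfl
  rw [h]
  refine ENNReal.measurable_toReal.comp (Measurable.tsum fun k => ?_)
  exact Measurable.indicator (ENNReal.measurable_ofReal.comp
    ((measurable_total k).comp measurable_snd)) (measurableSet_stopsAt_joint hh k)

/-! ### Optional stopping for a single turn. -/

/-- A stopping rule whose decisions are measurable functions of the spins. -/
def Rule.IsMeasurable (halts : Rule) : Prop :=
  ∀ k, MeasurableSet {v : Fin k → unitInterval | halts k v}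

section
variable {halts : Rule} (hh : halts.IsMeasurable)
include hh

theorem Rule.IsMeasurable.joint (k : ℕ) :
    MeasurableSet {q : Unit × (Fin k → unitInterval) | halts k q.2} :=
  measurable_snd (hh k)

theorem measurableSet_stillIn (k : ℕ) : MeasurableSet (stillIn halts k) :=
  measurable_prodMk_left (x := ()) (measurableSet_stillIn_joint (halts := fun _ => halts) hh.joint k)

theorem measurableSet_stopsAt (k : ℕ) : MeasurableSet (stopsAt halts k) :=
  measurable_prodMk_left (x := ()) (measurableSet_stopsAt_joint (halts := fun _ => halts) hh.joint k)

theorem measurable_turnScore : Measurable (turnScore halts) :=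
  (measurable_turnScore_joint (halts := fun _ : Unit => halts) hh.joint).comp
    (measurable_prodMk_left (x := ()))

theorem lintegral_turnScore {f : ℝ → ENNReal} (hf : Measurable f) (hf0 : f 0 = 0) :
    ∫⁻ z, f (turnScore halts z) ∂turnMeasure
      = ∑' k, ∫⁻ z in stopsAt halts k, f (total z k) ∂turnMeasure := by
  simp_rw [apply_turnScore_eq_tsum halts hf0]
  have hm : ∀ k, Measurable fun z => f (total z k) := fun k => hf.comp (measurable_total k)
  rw [lintegral_tsum fun k => ((hm k).indicator (measurableSet_stopsAt hh k)).aemeasurable]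
  refine tsum_congr fun k => ?_
  rw [lintegral_indicator (measurableSet_stopsAt hh k)]

/-- One step of the comparison of a payoff `v` with its expected value after one more spin. -/
theorem lintegral_stillIn_step {v D : ℝ → ENNReal} (hv : Measurable v) (hD : Measurable D)
    (hv1 : ∀ t, 1 < t → v t = 0)
    (hvD : ∀ t ∈ Icc (0 : ℝ) 1, v t = D t + ∫⁻ u : unitInterval, v (t + u)) (k : ℕ) :
    ∫⁻ z in stillIn halts k, v (total z k) ∂turnMeasure
      = ∫⁻ z in stopsAt halts k, v (total z k) ∂turnMeasure
        + ∫⁻ z in stillIn halts (k + 1), D (total z k) ∂turnMeasure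
        + ∫⁻ z in stillIn halts (k + 1), v (total z (k + 1)) ∂turnMeasure := by
  have hA := measurableSet_stillIn hh k
  have hA' := measurableSet_stillIn hh (k + 1)
  have hT := measurableSet_stopsAt hh k
  have hvm : ∀ k, Measurable fun z => v (total z k) := fun k => hv.comp (measurable_total k)
  have hDm : Measurable fun z => D (total z k) := hD.comp (measurable_total k)
  -- Average over spin `k` alone, which is independent of the event `stillIn halts (k + 1)` and of
  -- `total z k`.
  have h1 : ∫⁻ z in stillIn halts (k + 1), v (total z (k + 1)) ∂turnMeasure
      = ∫⁻ z in stillIn halts (k + 1), (∫⁻ u : unitInterval, v (total z k + u)) ∂turnMeasure := by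
    rw [← lintegral_indicator hA', ← lintegral_indicator hA']
    unfold turnMeasure
    rw [lintegral_infinitePi_update' _ k ((hvm _).indicator hA')]
    refine lintegral_congr fun z => ?_
    by_cases hz : z ∈ stillIn halts (k + 1)
    · rw [indicator_of_mem hz]
      refine lintegral_congr fun u => ?_
      rw [indicator_of_mem ((update_mem_stillIn halts k z u).2 hz), total_succ,
        total_update le_rfl, Function.update_self]
    · rw [indicator_of_notMem hz, lintegral_eq_zero_iff']
      · refine Filter.Eventually.of_forall fun u => ?_
        exact indicator_of_notMem (fun h => hz ((update_mem_stillIn halts k z u).1 h)) _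
      · refine Measurable.aemeasurable ?_
        exact ((hvm _).indicator hA').comp (measurable_update z)
  rw [h1, add_assoc, ← lintegral_add_left hDm]
  have h2 : ∫⁻ z in stillIn halts (k + 1), (D (total z k) + ∫⁻ u : unitInterval, v (total z k + u))
        ∂turnMeasure = ∫⁻ z in stillIn halts (k + 1), v (total z k) ∂turnMeasure := by
    refine setLIntegral_congr_fun hA' fun z hz => ?_
    rw [stillIn_succ] at hz
    exact (hvD _ ⟨total_nonneg z k, hz.2.1⟩).symm
  rw [h2, ← lintegral_indicator hA, ← lintegral_indicator hT, ← lintegral_indicator hA',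
    ← lintegral_add_left ((hvm k).indicator hT)]
  -- Pointwise, a turn still in progress at `k` has stopped, plays on, or has exceeded `1`, where
  -- `v` vanishes.
  refine lintegral_congr fun z => ?_
  by_cases hz : z ∈ stillIn halts k
  · rw [indicator_of_mem hz]
    by_cases ht : total z k ≤ 1
    · by_cases hs : halts k (fun l => z l)
      · rw [indicator_of_mem (show z ∈ stopsAt halts k from ⟨hz, ht, hs⟩), indicator_of_notMem,
          add_zero]
        rw [stillIn_succ]
        exact fun h => h.2.2 hs
      · rw [indicator_of_notMem (show z ∉ stopsAt halts k from fun h => hs h.2.2),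
          indicator_of_mem, zero_add]
        rw [stillIn_succ]
        exact ⟨hz, ht, hs⟩
    · rw [hv1 _ (not_le.1 ht), indicator_of_notMem (fun h => ht h.2.1), indicator_of_notMem,
        zero_add]
      rw [stillIn_succ]
      exact fun h => ht h.2.1
  · rw [indicator_of_notMem hz, indicator_of_notMem (fun h => hz h.1), indicator_of_notMem,
      zero_add]
    rw [stillIn_succ]
    exact fun h => hz h.1

/-- Telescopes the one-step identity. `D` is the charge for each decision to play on: `D = 1` counts
spins, and `D = playLoss v` measures the loss of value. -/
theorem eq_sum_add_lintegral_stillIn {v D : ℝ → ENNReal} (hv : Measurable v) (hD : Measurable D)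
    (hv1 : ∀ t, 1 < t → v t = 0)
    (hvD : ∀ t ∈ Icc (0 : ℝ) 1, v t = D t + ∫⁻ u : unitInterval, v (t + u)) (N : ℕ) :
    v 0 = ∑ k ∈ Finset.range N, (∫⁻ z in stopsAt halts k, v (total z k) ∂turnMeasure
        + ∫⁻ z in stillIn halts (k + 1), D (total z k) ∂turnMeasure)
        + ∫⁻ z in stillIn halts N, v (total z N) ∂turnMeasure := by
  induction N with
  | zero => simp [stillIn]
  | succ N ih =>
    rw [Finset.sum_range_succ, add_assoc, ← lintegral_stillIn_step hh hv hD hv1 hvD N]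
    exact ih
end

/-- For a payoff that vanishes beyond `1`, the mean after one more spin is an integral over
`[t, 1]`. -/
theorem lintegral_add_unitInterval {v : ℝ → ENNReal} (hv1 : ∀ t, 1 < t → v t = 0) {t : ℝ}
    (ht : t ∈ Icc (0 : ℝ) 1) :
    ∫⁻ u : unitInterval, v (t + u) = ∫⁻ x in Ioc t 1, v x := by
  rw [unitInterval.volume_def,
    lintegral_subtype_comap measurableSet_Icc (fun x : ℝ => v (t + x)),
    ← lintegral_indicator measurableSet_Icc]
  have h : ∀ x : ℝ, (Icc (0 : ℝ) 1).indicator (fun x => v (t + x)) x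
      = (Icc t 1).indicator v (t + x) := by
    intro x
    by_cases hx : x ∈ Icc (0 : ℝ) 1
    · rw [indicator_of_mem hx]
      by_cases hx' : t + x ≤ 1
      · rw [indicator_of_mem (show t + x ∈ Icc t 1 from ⟨by linarith [hx.1], hx'⟩)]
      · rw [hv1 _ (not_le.1 hx'), indicator_of_notMem (fun h => hx' h.2)]
    · rw [indicator_of_notMem hx, indicator_of_notMem]
      exact fun h => hx ⟨by linarith [h.1], by linarith [h.2, ht.1]⟩
  simp_rw [h]
  rw [lintegral_add_left_eq_self (μ := volume) (fun x => (Icc t 1).indicator v x) t,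
    lintegral_indicator measurableSet_Icc]
  exact (setLIntegral_congr Ioc_ae_eq_Icc).symm

theorem lintegral_Ioc_ofReal {g : ℝ → ℝ} {a b : ℝ} (hab : a ≤ b)
    (hg : IntervalIntegrable g volume a b) (hg0 : ∀ x ∈ Ioc a b, 0 ≤ g x) :
    ∫⁻ x in Ioc a b, ENNReal.ofReal (g x) = ENNReal.ofReal (∫ x in a..b, g x) := by
  rw [intervalIntegral.integral_of_le hab, ofReal_integral_eq_lintegral_ofReal]
  · exact (intervalIntegrable_iff_integrableOn_Ioc_of_le hab).1 hg
  · exact (ae_restrict_iff' measurableSet_Ioc).2 (Filter.Eventually.of_forall hg0)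

/-! ### The function `p` and the greed roots. -/

theorem continuous_p : Continuous p := by
  unfold p
  fun_prop

@[simp] theorem p_at_zero : p 0 = 0 := by simp [p]

@[simp] theorem p_at_one : p 1 = 1 := by simp [p]

theorem hasDerivAt_p (x : ℝ) : HasDerivAt p (Real.exp x * x) x := by
  have h := ((Real.hasDerivAt_exp x).mul ((hasDerivAt_id x).sub_const 1)).const_add 1
  refine h.congr_deriv ?_
  simp only [id]
  ring

theorem strictMonoOn_p : StrictMonoOn p (Ici 0) := by
  refine strictMonoOn_of_deriv_pos (convex_Ici 0) continuous_p.continuousOn fun x hx => ?_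
  rw [interior_Ici] at hx
  rw [(hasDerivAt_p x).deriv]
  exact mul_pos (Real.exp_pos x) hx

theorem p_nonneg {x : ℝ} (hx : 0 ≤ x) : 0 ≤ p x := by
  rw [← p_at_zero]
  exact strictMonoOn_p.monotoneOn (mem_Ici.2 le_rfl) hx hx

theorem p_pos {x : ℝ} (hx : 0 < x) : 0 < p x := by
  rw [← p_at_zero]
  exact strictMonoOn_p (mem_Ici.2 le_rfl) hx.le hx

theorem p_mono {x y : ℝ} (hx : 0 ≤ x) (hxy : x ≤ y) : p x ≤ p y :=
  strictMonoOn_p.monotoneOn hx (hx.trans hxy) hxy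

theorem intervalIntegrable_p_pow (r : ℕ) (a b : ℝ) :
    IntervalIntegrable (fun t => p t ^ r) volume a b :=
  (continuous_p.pow r).intervalIntegrable a b

theorem integral_p_pow_pos (r : ℕ) {x y : ℝ} (hx : 0 ≤ x) (hxy : x < y) :
    0 < ∫ t in x..y, p t ^ r :=
  intervalIntegral.intervalIntegral_pos_of_pos_on (intervalIntegrable_p_pow r x y)
    (fun _ ht => pow_pos (p_pos (hx.trans_lt ht.1)) r) hxy

/-- The difference of the two sides of the equation that defines the greed thresholds. -/
def greedGap (r : ℕ) (x : ℝ) : ℝ := p x ^ r - ∫ t in x..1, p t ^ r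

theorem isGreedRoot_iff (r : ℕ) (x : ℝ) :
    IsGreedRoot r x ↔ x ∈ Icc (0 : ℝ) 1 ∧ greedGap (r - 1) x = 0 := by
  rw [IsGreedRoot, greedGap, sub_eq_zero]

/-- The power of `p` does not decrease, and the integral strictly decreases because `p > 0` on `(0,
1]`. The case `r = 0` is covered too. -/
theorem strictMonoOn_greedGap (r : ℕ) : StrictMonoOn (greedGap r) (Icc 0 1) := by
  intro x hx y hy hxy
  have h1 : p x ^ r ≤ p y ^ r := pow_le_pow_left₀ (p_nonneg hx.1) (p_mono hx.1 hxy.le) r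
  have h2 := integral_p_pow_pos r hx.1 hxy
  have h3 := intervalIntegral.integral_add_adjacent_intervals
    (intervalIntegrable_p_pow r x y) (intervalIntegrable_p_pow r y 1)
  unfold greedGap
  linarith

theorem continuous_greedGap (r : ℕ) : Continuous (greedGap r) := by
  have h : greedGap r = fun x => p x ^ r + ∫ t in (1 : ℝ)..x, p t ^ r := by
    funext x
    rw [greedGap, intervalIntegral.integral_symm, sub_neg_eq_add]
  rw [h]
  exact (continuous_p.pow r).add (intervalIntegral.continuous_primitive
    (fun a b => intervalIntegrable_p_pow r a b) 1)

theorem greedGap_zero_nonpos (r : ℕ) : greedGap r 0 ≤ 0 := by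
  unfold greedGap
  rcases r.eq_zero_or_pos with rfl | hr
  · simp
  · have := integral_p_pow_pos r le_rfl one_pos
    rw [p_at_zero, zero_pow hr.ne']
    linarith

theorem greedGap_at_one (r : ℕ) : greedGap r 1 = 1 := by simp [greedGap]

theorem existsUnique_isGreedRoot (r : ℕ) : ∃! x, IsGreedRoot r x := by
  obtain ⟨x, hx, hx0⟩ := intermediate_value_Icc zero_le_one
    (continuous_greedGap (r - 1)).continuousOn
    ⟨greedGap_zero_nonpos (r - 1), by rw [greedGap_at_one]; exact zero_le_one⟩
  refine ⟨x, (isGreedRoot_iff r x).2 ⟨hx, hx0⟩, fun y hy => ?_⟩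
  obtain ⟨hy, hy0⟩ := (isGreedRoot_iff r y).1 hy
  exact (strictMonoOn_greedGap (r - 1)).injOn hy hx (hy0.trans hx0.symm)

theorem IsGreedRoot.lt_one {r : ℕ} {x : ℝ} (h : IsGreedRoot r x) : x < 1 := by
  obtain ⟨hx, h0⟩ := (isGreedRoot_iff r x).1 h
  refine lt_of_le_of_ne hx.2 ?_
  rintro rfl
  rw [greedGap_at_one] at h0
  exact one_ne_zero h0

/-- Multiply the equation of `x` by `p x`: since `p x ≤ p t` on `[x, 1]`, the next gap is
nonpositive at `x`, so its root cannot lie to the left of `x`. -/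
theorem IsGreedRoot.le_succ {r : ℕ} {x y : ℝ} (hx : IsGreedRoot (r + 1) x)
    (hy : IsGreedRoot (r + 2) y) : x ≤ y := by
  obtain ⟨hxI, hx0⟩ := (isGreedRoot_iff _ x).1 hx
  obtain ⟨hyI, hy0⟩ := (isGreedRoot_iff _ y).1 hy
  by_contra! hlt
  have h1 := strictMonoOn_greedGap (r + 2 - 1) hyI hxI hlt
  rw [hy0] at h1
  have h2 : p x * ∫ t in x..1, p t ^ r ≤ ∫ t in x..1, p t ^ (r + 1) := by
    rw [← intervalIntegral.integral_const_mul]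
    refine intervalIntegral.integral_mono_on hxI.2
      ((intervalIntegrable_p_pow r x 1).const_mul _) (intervalIntegrable_p_pow (r + 1) x 1)
      fun t ht => ?_
    rw [pow_succ']
    exact mul_le_mul_of_nonneg_right (p_mono hxI.1 ht.1)
      (pow_nonneg (p_nonneg (hxI.1.trans ht.1)) r)
  have h3 : p x ^ r = ∫ t in x..1, p t ^ r := sub_eq_zero.1 hx0
  rw [← h3, ← pow_succ'] at h2
  have h4 : greedGap (r + 2 - 1) x ≤ 0 := sub_nonpos.2 h2
  linarith

theorem greedRoot_mono {θ : ℕ → ℝ} (hθ : ∀ r, 1 ≤ r → IsGreedRoot r (θ r)) {j r : ℕ}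
    (hj : 1 ≤ j) (hjr : j ≤ r) : θ j ≤ θ r := by
  induction r, hjr using Nat.le_induction with
  | base => exact le_rfl
  | succ r hr ih =>
    obtain ⟨q, rfl⟩ : ∃ q, r = q + 1 := ⟨r - 1, by omega⟩
    exact ih.trans ((hθ _ (by omega)).le_succ (hθ _ (by omega)))

/-! ### The payoff of a score. -/

/-- The probability that the last `r` players all fail to beat the score `y`. -/
def failProb (θ : ℕ → ℝ) (r : ℕ) (y : ℝ) : ℝ := ∏ j ∈ Finset.range r, p (max (θ (j + 1)) y)

section
variable {θ : ℕ → ℝ} (hθ : ∀ r, 1 ≤ r → IsGreedRoot r (θ r))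
include hθ

theorem max_greedRoot_nonneg (j : ℕ) (y : ℝ) : 0 ≤ max (θ (j + 1)) y :=
  (hθ (j + 1) (by omega)).1.1.trans (le_max_left _ _)

theorem failProb_nonneg (r : ℕ) (y : ℝ) : 0 ≤ failProb θ r y :=
  Finset.prod_nonneg fun j _ => p_nonneg (max_greedRoot_nonneg hθ j y)

theorem monotone_failProb (r : ℕ) : Monotone (failProb θ r) := fun x _ hxy =>
  Finset.prod_le_prod (fun j _ => p_nonneg (max_greedRoot_nonneg hθ j x)) fun j _ =>
    p_mono (max_greedRoot_nonneg hθ j x) (max_le_max le_rfl hxy)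

/-- By monotonicity of the roots, `y` exceeds the own threshold of every later player, so each
maximum is `y`. -/
theorem failProb_eq_pow {r : ℕ} {y : ℝ} (hy : θ (r + 1) ≤ y) : failProb θ r y = p y ^ r := by
  rw [failProb, Finset.prod_congr rfl (g := fun _ => p y), Finset.prod_const, Finset.card_range]
  intro j hj
  rw [max_eq_right]
  exact (greedRoot_mono hθ (by omega) (by have := Finset.mem_range.1 hj; omega)).trans hy
end

/-- The winning probability with score `y`, if `m` is the best earlier score and `r` players are
still to play afterwards. -/
def payoff (θ : ℕ → ℝ) (r : ℕ) (m y : ℝ) : ℝ := if m < y then failProb θ r y else 0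

/-- The properties of a payoff that make `κ` the optimal greed threshold. -/
structure IsThresholdPayoff (G : ℝ → ℝ) (κ : ℝ) : Prop where
  mono : Monotone G
  nonneg : ∀ t, 0 ≤ G t
  zero : G 0 = 0
  mem : κ ∈ Ico (0 : ℝ) 1
  le_integral : G κ ≤ ∫ t in κ..1, G t
  integral_pos : 0 < ∫ t in κ..1, G t
  integral_lt : ∀ t, κ < t → t ≤ 1 → ∫ x in t..1, G x < G t

section
variable {θ : ℕ → ℝ} (hθ : ∀ r, 1 ≤ r → IsGreedRoot r (θ r))
include hθ

theorem payoff_nonneg (r : ℕ) (m y : ℝ) : 0 ≤ payoff θ r m y := by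
  unfold payoff
  split_ifs
  exacts [failProb_nonneg hθ r y, le_rfl]

theorem monotone_payoff (r : ℕ) (m : ℝ) : Monotone (payoff θ r m) := by
  intro x y hxy
  by_cases hx : m < x
  · rw [payoff, payoff, if_pos hx, if_pos (hx.trans_le hxy)]
    exact monotone_failProb hθ r hxy
  · rw [payoff, if_neg hx]
    exact payoff_nonneg hθ r m y

theorem isThresholdPayoff (r : ℕ) {m : ℝ} (hm0 : 0 ≤ m) (hm1 : m < 1) :
    IsThresholdPayoff (payoff θ r m) (max (θ (r + 1)) m) := by
  set κ := max (θ (r + 1)) m with hκ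
  have hroot := hθ (r + 1) (by omega)
  have h0 : 0 ≤ κ := hm0.trans (le_max_right _ _)
  have h1 : κ < 1 := max_lt hroot.lt_one hm1
  have heq : ∀ y, κ < y → payoff θ r m y = p y ^ r := fun y hy => by
    rw [payoff, if_pos ((le_max_right _ _).trans_lt hy),
      failProb_eq_pow hθ ((le_max_left _ _).trans hy.le)]
  have hint : ∀ t, κ ≤ t → t ≤ 1 → ∫ x in t..1, payoff θ r m x = ∫ x in t..1, p x ^ r := by
    intro t ht ht1
    rw [intervalIntegral.integral_of_le ht1, intervalIntegral.integral_of_le ht1]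
    exact setIntegral_congr_fun measurableSet_Ioc fun x hx => heq x (ht.trans_lt hx.1)
  obtain ⟨hθI, hθ0⟩ := (isGreedRoot_iff _ _).1 hroot
  refine ⟨monotone_payoff hθ r m, payoff_nonneg hθ r m, if_neg (not_lt.2 hm0), ⟨h0, h1⟩, ?_, ?_, ?_⟩
  · rw [hint κ le_rfl h1.le]
    -- If `κ` is the root, equality holds by its equation. If `κ = m`, the payoff at `κ` is `0`,
    -- since `m` must be beaten strictly; hence only an inequality in `le_integral`.
    by_cases hlt : m < θ (r + 1)
    · have hk : κ = θ (r + 1) := max_eq_left hlt.le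
      rw [hk, payoff, if_pos hlt, failProb_eq_pow hθ le_rfl]
      exact (sub_eq_zero.1 hθ0).le
    · have hk : κ = m := max_eq_right (not_lt.1 hlt)
      rw [hk, payoff, if_neg (lt_irrefl m), ← hk]
      exact (integral_p_pow_pos r h0 h1).le
  · rw [hint κ le_rfl h1.le]
    exact integral_p_pow_pos r h0 h1
  · intro t ht ht1
    rw [hint t ht.le ht1, heq t ht, ← sub_pos]
    have := strictMonoOn_greedGap r hθI ⟨h0.trans ht.le, ht1⟩ ((le_max_left _ _).trans_lt ht)
    rwa [show greedGap r (θ (r + 1)) = 0 from hθ0] at this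
end

/-! ### Turns end almost surely; single scores are null events. -/

theorem measurable_lintegral_add {v : ℝ → ENNReal} (hv : Measurable v) :
    Measurable fun t : ℝ => ∫⁻ u : unitInterval, v (t + u) := by
  have h : Measurable fun q : ℝ × unitInterval => v (q.1 + q.2) := hv.comp (by fun_prop)
  exact h.lintegral_prod_right'

/-- What is lost at the total `t` by playing on instead of taking `v t`. -/
def playLoss (v : ℝ → ENNReal) (t : ℝ) : ENNReal := v t - ∫⁻ u : unitInterval, v (t + u)

theorem measurable_playLoss {v : ℝ → ENNReal} (hv : Measurable v) : Measurable (playLoss v) :=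
  hv.sub (measurable_lintegral_add hv)

theorem integral_exp_const_sub (c a b : ℝ) :
    ∫ x in a..b, Real.exp (c - x) = Real.exp (c - a) - Real.exp (c - b) := by
  rw [intervalIntegral.integral_comp_sub_left (fun x => Real.exp x) c, integral_exp]

/-- `v t = e^(1 - t)` is the expected number of spins that carry the total from `t` beyond `1`.
Charging `1` per spin bounds the sum of these probabilities by `v 0 = e`, so they tend to `0`. -/
theorem tendsto_measure_stillIn {halts : Rule} (hh : halts.IsMeasurable) :
    Filter.Tendsto (fun N => turnMeasure (stillIn halts N)) Filter.atTop (nhds 0) := by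
  set v : ℝ → ENNReal := (Iic (1 : ℝ)).indicator fun t => ENNReal.ofReal (Real.exp (1 - t)) with hv
  have hvm : Measurable v := Measurable.indicator (by fun_prop) measurableSet_Iic
  have hv1 : ∀ t, 1 < t → v t = 0 := fun t ht =>
    indicator_of_notMem (s := Iic (1 : ℝ)) (not_le.2 ht) _
  have hvD : ∀ t ∈ Icc (0 : ℝ) 1, v t = 1 + ∫⁻ u : unitInterval, v (t + u) := by
    intro t ht
    have hc : Continuous fun x : ℝ => Real.exp (1 - x) := by fun_prop
    have h1 : ∫⁻ x in Ioc t 1, v x = ENNReal.ofReal (Real.exp (1 - t) - 1) := by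
      rw [setLIntegral_congr_fun (g := fun x => ENNReal.ofReal (Real.exp (1 - x)))
        measurableSet_Ioc fun x hx => indicator_of_mem (mem_Iic.2 hx.2) _,
        lintegral_Ioc_ofReal ht.2 (hc.intervalIntegrable _ _) fun x _ => (Real.exp_pos _).le,
        integral_exp_const_sub, sub_self, Real.exp_zero]
    have h2 : 1 ≤ Real.exp (1 - t) := Real.one_le_exp (by linarith [ht.2])
    rw [lintegral_add_unitInterval hv1 ht, h1, hv, indicator_of_mem (mem_Iic.2 ht.2),
      ← ENNReal.ofReal_one, ← ENNReal.ofReal_add zero_le_one (by linarith)]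
    congr 1
    ring
  have hsum : ∑' k, turnMeasure (stillIn halts (k + 1)) ≠ ⊤ := by
    refine ne_top_of_le_ne_top (b := v 0) ?_ (ENNReal.tsum_le_of_sum_range_le fun N => ?_)
    · rw [hv, indicator_of_mem (mem_Iic.2 zero_le_one)]
      exact ENNReal.ofReal_ne_top
    · rw [eq_sum_add_lintegral_stillIn hh hvm measurable_const hv1 hvD N]
      refine le_add_right (Finset.sum_le_sum fun k _ => ?_)
      rw [setLIntegral_const, one_mul]
      exact le_add_self
  exact (Filter.tendsto_add_atTop_iff_nat 1).1 (ENNReal.tendsto_atTop_zero_of_tsum_ne_top hsum)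

/-- The value of a payoff that is never improved by playing on, split into what a strategy obtains
and what it loses by playing on. -/
theorem eq_tsum_stopsAt_add_playLoss {halts : Rule} (hh : halts.IsMeasurable) {v : ℝ → ENNReal}
    (hv : Measurable v) (hv1 : ∀ t, 1 < t → v t = 0) {B : ENNReal} (hB : B ≠ ⊤)
    (hvB : ∀ t, 0 ≤ t → v t ≤ B)
    (hsup : ∀ t ∈ Icc (0 : ℝ) 1, ∫⁻ u : unitInterval, v (t + u) ≤ v t) :
    v 0 = ∑' k, (∫⁻ z in stopsAt halts k, v (total z k) ∂turnMeasure
        + ∫⁻ z in stillIn halts (k + 1), playLoss v (total z k) ∂turnMeasure) := by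
  have h0 : Filter.Tendsto (fun N => ∫⁻ z in stillIn halts N, v (total z N) ∂turnMeasure)
      Filter.atTop (nhds 0) := by
    have h1 : Filter.Tendsto (fun N => B * turnMeasure (stillIn halts N)) Filter.atTop (nhds 0) := by
      have := ENNReal.Tendsto.const_mul (tendsto_measure_stillIn hh) (Or.inr hB)
      rwa [mul_zero] at this
    refine tendsto_of_tendsto_of_tendsto_of_le_of_le tendsto_const_nhds h1
      (fun _ => zero_le) fun N => ?_
    calc ∫⁻ z in stillIn halts N, v (total z N) ∂turnMeasure
        ≤ ∫⁻ _ in stillIn halts N, B ∂turnMeasure :=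
          lintegral_mono fun z => hvB _ (total_nonneg z N)
      _ = B * turnMeasure (stillIn halts N) := setLIntegral_const _ _
  have h2 := (ENNReal.tendsto_nat_tsum fun k => ∫⁻ z in stopsAt halts k, v (total z k) ∂turnMeasure
        + ∫⁻ z in stillIn halts (k + 1), playLoss v (total z k) ∂turnMeasure).add h0
  rw [add_zero] at h2
  refine tendsto_nhds_unique ?_ h2
  have h3 := eq_sum_add_lintegral_stillIn hh hv (measurable_playLoss hv) hv1
    fun t ht => (tsub_add_cancel_of_le (hsup t ht)).symm
  exact tendsto_const_nhds.congr h3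

/-- Given the other spins, at most one value of spin `k` produces the total `c`. -/
theorem measure_total_succ_eq (k : ℕ) (c : ℝ) :
    turnMeasure {z | total z (k + 1) = c} = 0 := by
  have hm : MeasurableSet {z | total z (k + 1) = c} :=
    measurable_total (k + 1) (measurableSet_singleton c)
  rw [← lintegral_indicator_one hm]
  unfold turnMeasure
  rw [lintegral_infinitePi_update' _ k (measurable_one.indicator hm), lintegral_eq_zero_iff']
  · refine Filter.Eventually.of_forall fun z => ?_
    have hs : MeasurableSet {u : unitInterval | total z k + u = c} :=
      measurableSet_eq_fun (by fun_prop) measurable_const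
    have : ∀ u : unitInterval, {z | total z (k + 1) = c}.indicator (1 : (ℕ → unitInterval) → ENNReal)
        (Function.update z k u) = {u : unitInterval | total z k + u = c}.indicator 1 u := by
      intro u
      refine indicator_eq_indicator ?_ rfl
      rw [mem_ofPred_eq, mem_ofPred_eq, total_succ, total_update le_rfl, Function.update_self]
    simp_rw [this]
    rw [lintegral_indicator_one hs]
    refine Set.Subsingleton.measure_zero (fun a ha b hb => Subtype.ext ?_) _
    have ha : total z k + a = c := ha
    have hb : total z k + b = c := hb
    linarith
  · have := (measurable_one (α := ENNReal)).indicator hm |>.comp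
      (measurable_update' (a := k) (X := fun _ : ℕ => unitInterval))
    exact (Measurable.lintegral_prod_right' this).aemeasurable

theorem measure_turnScore_eq {halts : Rule} {c : ℝ} (hc : 0 < c) :
    turnMeasure {z | turnScore halts z = c} = 0 := by
  refine measure_mono_null (t := ⋃ k, {z | total z (k + 1) = c}) ?_
    (measure_iUnion_null fun k => measure_total_succ_eq k c)
  intro z hz
  have hz : turnScore halts z = c := hz
  by_cases h : ∃ k, z ∈ stopsAt halts k
  · obtain ⟨k, hk⟩ := h
    rw [turnScore_of_stopsAt hk] at hz
    cases k with
    | zero => exact absurd hz (by simpa using hc.ne)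
    | succ k => exact mem_iUnion.2 ⟨k, hz⟩
  · push Not at h
    rw [turnScore_of_not_stopsAt h] at hz
    exact absurd hz hc.ne

/-! ### The value function of a threshold. -/

/-- The expected payoff, from the total `t` on, of the greed threshold `κ`. -/
def thresholdValue (G : ℝ → ℝ) (κ t : ℝ) : ℝ :=
  if t ≤ κ then Real.exp (κ - t) * ∫ x in κ..1, G x else if t ≤ 1 then G t else 0

theorem thresholdValue_of_le {G : ℝ → ℝ} {κ t : ℝ} (ht : t ≤ κ) :
    thresholdValue G κ t = Real.exp (κ - t) * ∫ x in κ..1, G x := if_pos ht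

section
variable {G : ℝ → ℝ} {κ : ℝ} (hG : Monotone G) (hG0 : ∀ t, 0 ≤ G t) (hκ : κ ∈ Ico (0 : ℝ) 1)
include hG hG0 hκ

omit hκ hG0 in
theorem measurable_thresholdValue : Measurable (thresholdValue G κ) := by
  refine Measurable.ite measurableSet_Iic (by fun_prop) ?_
  exact Measurable.ite measurableSet_Iic hG.measurable measurable_const

omit hG hG0 in
theorem thresholdValue_of_one_lt {t : ℝ} (ht : 1 < t) : thresholdValue G κ t = 0 := by
  rw [thresholdValue, if_neg (not_le.2 (hκ.2.trans ht)), if_neg (not_le.2 ht)]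

omit hG in
theorem integral_nonneg_of_nonneg : 0 ≤ ∫ x in κ..1, G x :=
  intervalIntegral.integral_nonneg hκ.2.le fun x _ => hG0 x

theorem thresholdValue_le {t : ℝ} (ht : 0 ≤ t) :
    thresholdValue G κ t ≤ Real.exp κ * (∫ x in κ..1, G x) + G 1 := by
  have hI := integral_nonneg_of_nonneg hG0 hκ
  have h1 : 0 ≤ Real.exp κ * ∫ x in κ..1, G x := mul_nonneg (Real.exp_pos _).le hI
  unfold thresholdValue
  split_ifs with h h'
  · have := mul_le_mul_of_nonneg_right (Real.exp_le_exp.2 (sub_le_self κ ht)) hI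
    linarith [hG0 1]
  · linarith [hG h']
  · linarith [hG0 1]

theorem lintegral_thresholdValue_of_lt {t : ℝ} (ht : κ < t) (ht1 : t ≤ 1) :
    ∫⁻ u : unitInterval, ENNReal.ofReal (thresholdValue G κ (t + u))
      = ENNReal.ofReal (∫ x in t..1, G x) := by
  rw [lintegral_add_unitInterval (v := fun t => ENNReal.ofReal (thresholdValue G κ t))
    (fun t ht => by rw [thresholdValue_of_one_lt hκ ht, ENNReal.ofReal_zero])
    ⟨hκ.1.trans ht.le, ht1⟩, ← lintegral_Ioc_ofReal ht1 hG.intervalIntegrable fun x _ => hG0 x]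
  refine setLIntegral_congr_fun measurableSet_Ioc fun x hx => ?_
  simp only [thresholdValue]
  rw [if_neg (not_le.2 (ht.trans hx.1)), if_pos hx.2]

/-- Below `κ` playing on is a fair game: the exponential solves `V t = ∫_t^κ V + ∫_κ^1 G`. -/
theorem lintegral_thresholdValue_of_le {t : ℝ} (ht0 : 0 ≤ t) (ht : t ≤ κ) :
    ∫⁻ u : unitInterval, ENNReal.ofReal (thresholdValue G κ (t + u))
      = ENNReal.ofReal (thresholdValue G κ t) := by
  have hI := integral_nonneg_of_nonneg hG0 hκ
  rw [lintegral_add_unitInterval (v := fun t => ENNReal.ofReal (thresholdValue G κ t))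
    (fun t ht => by rw [thresholdValue_of_one_lt hκ ht, ENNReal.ofReal_zero])
    ⟨ht0, ht.trans hκ.2.le⟩, ← Ioc_union_Ioc_eq_Ioc ht hκ.2.le,
    lintegral_union measurableSet_Ioc (Ioc_disjoint_Ioc_of_le le_rfl)]
  have h1 : ∫⁻ x in Ioc t κ, ENNReal.ofReal (thresholdValue G κ x)
      = ENNReal.ofReal ((Real.exp (κ - t) - 1) * ∫ x in κ..1, G x) := by
    have hc : Continuous fun x => Real.exp (κ - x) * ∫ x in κ..1, G x := by fun_prop
    rw [setLIntegral_congr_fun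
      (g := fun x => ENNReal.ofReal (Real.exp (κ - x) * ∫ x in κ..1, G x)) measurableSet_Ioc
      fun x hx => by simp only [thresholdValue]; rw [if_pos hx.2],
      lintegral_Ioc_ofReal ht (hc.intervalIntegrable _ _)
        fun x _ => mul_nonneg (Real.exp_pos _).le hI,
      intervalIntegral.integral_mul_const, integral_exp_const_sub, sub_self, Real.exp_zero]
  have h2 : ∫⁻ x in Ioc κ 1, ENNReal.ofReal (thresholdValue G κ x)
      = ENNReal.ofReal (∫ x in κ..1, G x) := by
    rw [← lintegral_Ioc_ofReal hκ.2.le hG.intervalIntegrable fun x _ => hG0 x]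
    refine setLIntegral_congr_fun measurableSet_Ioc fun x hx => ?_
    simp only [thresholdValue]
    rw [if_neg (not_le.2 hx.1), if_pos hx.2]
  rw [h1, h2, ← ENNReal.ofReal_add, thresholdValue, if_pos ht]
  · congr 1
    ring
  · have : 1 ≤ Real.exp (κ - t) := Real.one_le_exp (by linarith)
    exact mul_nonneg (by linarith) hI
  · exact hI

theorem eq_tsum_thresholdValue (hlt : ∀ t, κ < t → t ≤ 1 → ∫ x in t..1, G x < G t)
    {halts : Rule} (hh : halts.IsMeasurable) :
    ENNReal.ofReal (thresholdValue G κ 0) =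
      ∑' k, (∫⁻ z in stopsAt halts k, ENNReal.ofReal (thresholdValue G κ (total z k)) ∂turnMeasure
        + ∫⁻ z in stillIn halts (k + 1),
          playLoss (fun t => ENNReal.ofReal (thresholdValue G κ t)) (total z k) ∂turnMeasure) := by
  refine eq_tsum_stopsAt_add_playLoss hh (v := fun t => ENNReal.ofReal (thresholdValue G κ t))
    (measurable_thresholdValue hG).ennreal_ofReal
    (fun t ht => by rw [thresholdValue_of_one_lt hκ ht, ENNReal.ofReal_zero])
    ENNReal.ofReal_ne_top
    (fun t ht => ENNReal.ofReal_le_ofReal (thresholdValue_le hG hG0 hκ ht)) fun t ht => ?_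
  rcases le_or_gt t κ with h | h
  · exact (lintegral_thresholdValue_of_le hG hG0 hκ ht.1 h).le
  · rw [lintegral_thresholdValue_of_lt hG hG0 hκ h ht.2]
    refine ENNReal.ofReal_le_ofReal ?_
    rw [thresholdValue, if_neg (not_le.2 h), if_pos ht.2]
    exact (hlt t h ht.2).le

theorem playLoss_thresholdValue_of_le {t : ℝ} (ht0 : 0 ≤ t) (ht : t ≤ κ) :
    playLoss (fun t => ENNReal.ofReal (thresholdValue G κ t)) t = 0 := by
  rw [playLoss, lintegral_thresholdValue_of_le hG hG0 hκ ht0 ht, tsub_self]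

theorem playLoss_thresholdValue_of_lt (hlt : ∀ t, κ < t → t ≤ 1 → ∫ x in t..1, G x < G t)
    {t : ℝ} (ht : κ < t) (ht1 : t ≤ 1) :
    playLoss (fun t => ENNReal.ofReal (thresholdValue G κ t)) t ≠ 0 := by
  rw [playLoss, lintegral_thresholdValue_of_lt hG hG0 hκ ht ht1, thresholdValue,
    if_neg (not_le.2 ht), if_pos ht1]
  have h := hlt t ht ht1
  have h0 : 0 ≤ ∫ x in t..1, G x := intervalIntegral.integral_nonneg ht1 fun x _ => hG0 x
  exact (tsub_pos_of_lt ((ENNReal.ofReal_lt_ofReal_iff (h0.trans_lt h)).2 h)).ne'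
end

/-! ### Optimal stopping rules for a threshold payoff. -/

namespace IsThresholdPayoff

variable {G : ℝ → ℝ} {κ : ℝ} (hG : IsThresholdPayoff G κ)
include hG

theorem le_thresholdValue {t : ℝ} (ht1 : t ≤ 1) : G t ≤ thresholdValue G κ t := by
  rcases le_or_gt t κ with h | h
  · rw [thresholdValue_of_le h]
    have h1 : 1 ≤ Real.exp (κ - t) := Real.one_le_exp (by linarith)
    nlinarith [hG.mono h, hG.le_integral, hG.integral_pos]
  · rw [thresholdValue, if_neg (not_le.2 h), if_pos ht1]

theorem lt_thresholdValue {t : ℝ} (ht : t < κ) : G t < thresholdValue G κ t := by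
  rw [thresholdValue_of_le ht.le]
  have h1 : 1 < Real.exp (κ - t) := Real.one_lt_exp_iff.2 (by linarith)
  nlinarith [hG.mono ht.le, hG.le_integral, hG.integral_pos]

theorem zero_lt_thresholdValue : G 0 < thresholdValue G κ 0 := by
  rw [thresholdValue_of_le hG.mem.1, hG.zero]
  exact mul_pos (Real.exp_pos _) hG.integral_pos

theorem measurable_ofReal : Measurable fun t => ENNReal.ofReal (G t) :=
  hG.mono.measurable.ennreal_ofReal

/-- What a strategy loses by stopping too early and by playing on for too long. -/
theorem value_eq_add_loss {halts : Rule} (hh : halts.IsMeasurable) :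
    ENNReal.ofReal (thresholdValue G κ 0)
      = ∫⁻ z, ENNReal.ofReal (G (turnScore halts z)) ∂turnMeasure
        + ∑' k, (∫⁻ z in stopsAt halts k,
              ENNReal.ofReal (thresholdValue G κ (total z k) - G (total z k)) ∂turnMeasure
            + ∫⁻ z in stillIn halts (k + 1),
              playLoss (fun t => ENNReal.ofReal (thresholdValue G κ t)) (total z k)
                ∂turnMeasure) := by
  rw [eq_tsum_thresholdValue hG.mono hG.nonneg hG.mem hG.integral_lt hh,
    lintegral_turnScore hh (f := fun t => ENNReal.ofReal (G t)) hG.measurable_ofReal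
      (by simp [hG.zero]), ← ENNReal.tsum_add]
  refine tsum_congr fun k => ?_
  have hm : Measurable fun z => ENNReal.ofReal (G (total z k)) :=
    hG.measurable_ofReal.comp (measurable_total k)
  rw [← add_assoc, ← lintegral_add_left hm]
  congr 1
  refine setLIntegral_congr_fun (measurableSet_stopsAt hh k) fun z hz => ?_
  rw [← ENNReal.ofReal_add (hG.nonneg _) (sub_nonneg.2 (hG.le_thresholdValue hz.2.1)),
    add_sub_cancel]

theorem lintegral_turnScore_le {halts : Rule} (hh : halts.IsMeasurable) :
    ∫⁻ z, ENNReal.ofReal (G (turnScore halts z)) ∂turnMeasure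
      ≤ ENNReal.ofReal (thresholdValue G κ 0) := by
  rw [hG.value_eq_add_loss hh]
  exact le_self_add

theorem lintegral_turnScore_threshold {halts : Rule} (hh : halts.IsMeasurable)
    (hκ : ∀ k v, halts k v ↔ κ < ∑ j, (v j : ℝ)) :
    ∫⁻ z, ENNReal.ofReal (G (turnScore halts z)) ∂turnMeasure
      = ENNReal.ofReal (thresholdValue G κ 0) := by
  rw [hG.value_eq_add_loss hh, ENNReal.tsum_eq_zero.2, add_zero]
  intro k
  have htot : ∀ z : ℕ → unitInterval, halts k (fun l => z l) ↔ κ < total z k := fun z => by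
    rw [hκ, total, ← Fin.sum_univ_eq_sum_range (fun j => (z j : ℝ))]
  rw [add_eq_zero]
  constructor
  · rw [setLIntegral_congr_fun (g := fun _ => 0) (measurableSet_stopsAt hh k), lintegral_zero]
    intro z hz
    have h1 := (htot z).1 hz.2.2
    simp only [thresholdValue]
    rw [if_neg (not_le.2 h1), if_pos hz.2.1, sub_self, ENNReal.ofReal_zero]
  · rw [setLIntegral_congr_fun (g := fun _ => 0) (measurableSet_stillIn hh (k + 1)),
      lintegral_zero]
    intro z hz
    rw [stillIn_succ] at hz
    exact playLoss_thresholdValue_of_le hG.mono hG.nonneg hG.mem (total_nonneg z k)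
      (not_lt.1 fun h => hz.2.2 ((htot z).2 h))

section
variable {halts : Rule} (hh : halts.IsMeasurable)
  (hopt : ∫⁻ z, ENNReal.ofReal (G (turnScore halts z)) ∂turnMeasure
      = ENNReal.ofReal (thresholdValue G κ 0))
include hh hopt

theorem loss_eq_zero (k : ℕ) :
    ∫⁻ z in stopsAt halts k, ENNReal.ofReal (thresholdValue G κ (total z k) - G (total z k))
        ∂turnMeasure = 0 ∧
      ∫⁻ z in stillIn halts (k + 1),
        playLoss (fun t => ENNReal.ofReal (thresholdValue G κ t)) (total z k) ∂turnMeasure = 0 := by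
  have h := hG.value_eq_add_loss hh
  rw [hopt] at h
  have h0 := ENNReal.tsum_eq_zero.1 ((ENNReal.add_right_inj ENNReal.ofReal_ne_top
    (b := 0)).1 (by rw [add_zero]; exact h)).symm k
  exact add_eq_zero.1 h0

theorem ae_lt_of_stopsAt (k : ℕ) :
    ∀ᵐ z ∂turnMeasure, z ∈ stopsAt halts k → κ < total z k := by
  have h := (hG.loss_eq_zero hh hopt k).1
  have hm : Measurable fun z =>
      ENNReal.ofReal (thresholdValue G κ (total z k) - G (total z k)) :=
    (((measurable_thresholdValue hG.mono).sub hG.mono.measurable).comp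
      (measurable_total k)).ennreal_ofReal
  rw [lintegral_eq_zero_iff hm, Filter.EventuallyEq,
    ae_restrict_iff' (measurableSet_stopsAt hh k)] at h
  have hle : ∀ᵐ z ∂turnMeasure, z ∈ stopsAt halts k →
      thresholdValue G κ (total z k) ≤ G (total z k) := by
    filter_upwards [h] with z hz hzs
    exact sub_nonpos.1 (ENNReal.ofReal_eq_zero.1 (hz hzs))
  -- The loss `V - G` may vanish at the total `κ` itself, a null event after at least one spin.
  -- Before any spin the total is surely `0`, possibly equal to `κ`, and there `G 0 = 0 < V 0`.
  cases k with
  | zero =>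
    filter_upwards [hle] with z hz hzs
    exact absurd (hz hzs) (not_le.2 (by simpa using hG.zero_lt_thresholdValue))
  | succ k =>
    have hne : ∀ᵐ z ∂turnMeasure, total z (k + 1) ≠ κ := by
      simpa only [ae_iff, ne_eq, not_not] using measure_total_succ_eq k κ
    filter_upwards [hle, hne] with z hz hzne hzs
    exact lt_of_le_of_ne
      (not_lt.1 fun hlt => absurd (hz hzs) (not_le.2 (hG.lt_thresholdValue hlt))) hzne.symm

theorem ae_le_of_stillIn (k : ℕ) :
    ∀ᵐ z ∂turnMeasure, z ∈ stillIn halts (k + 1) → total z k ≤ κ := by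
  have h := (hG.loss_eq_zero hh hopt k).2
  have hm : Measurable fun z =>
      playLoss (fun t => ENNReal.ofReal (thresholdValue G κ t)) (total z k) :=
    (measurable_playLoss (measurable_thresholdValue hG.mono).ennreal_ofReal).comp
      (measurable_total k)
  rw [lintegral_eq_zero_iff hm, Filter.EventuallyEq,
    ae_restrict_iff' (measurableSet_stillIn hh (k + 1))] at h
  filter_upwards [h] with z hz hzs
  have h0 := hz hzs
  rw [stillIn_succ] at hzs
  exact not_lt.1 fun hlt =>
    playLoss_thresholdValue_of_lt hG.mono hG.nonneg hG.mem hG.integral_lt hlt hzs.2.1 h0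

/-- With an optimal strategy, the probability of not beating a score `x ≤ κ` is `p κ`. -/
theorem measure_turnScore_lt {x : ℝ} (hx0 : 0 < x) (hx : x ≤ κ) :
    turnMeasure {z | turnScore halts z < x} = ENNReal.ofReal (p κ) := by
  have hκ0 : 0 < κ := hx0.trans_le hx
  -- The balance for the constant payoff `1`, whose value at `0` is `e^κ (1 - κ)`. Optimality for
  -- `G` makes the rule play on only up to `κ`, so it loses nothing here either.
  have h1 := eq_tsum_thresholdValue (G := fun _ => 1) (κ := κ) monotone_const
    (fun _ => zero_le_one) hG.mem (fun t ht _ => by simpa using hκ0.trans ht) hh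
  set f : ℝ → ENNReal := (Ici x).indicator 1 with hf
  have h2 := lintegral_turnScore hh (f := f) (measurable_one.indicator measurableSet_Ici)
    (indicator_of_notMem (not_le.2 hx0) _)
  have h3 : ∫⁻ z, f (turnScore halts z) ∂turnMeasure
      = ENNReal.ofReal (thresholdValue (fun _ => 1) κ 0) := by
    rw [h1, h2]
    refine tsum_congr fun k => ?_
    have h4 : ∫⁻ z in stillIn halts (k + 1), playLoss
        (fun t => ENNReal.ofReal (thresholdValue (fun _ => 1) κ t)) (total z k) ∂turnMeasure
        = 0 := by
      rw [setLIntegral_congr_fun_ae (g := fun _ => 0) (measurableSet_stillIn hh (k + 1)),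
        lintegral_zero]
      filter_upwards [hG.ae_le_of_stillIn hh hopt k] with z hz hzs
      exact playLoss_thresholdValue_of_le monotone_const (fun _ => zero_le_one) hG.mem
        (total_nonneg z k) (hz hzs)
    rw [h4, add_zero]
    refine setLIntegral_congr_fun_ae (measurableSet_stopsAt hh k) ?_
    filter_upwards [hG.ae_lt_of_stopsAt hh hopt k] with z hz hzs
    have h5 := hz hzs
    rw [hf, indicator_of_mem (mem_Ici.2 (hx.trans h5.le)), thresholdValue,
      if_neg (not_le.2 h5), if_pos hzs.2.1, ENNReal.ofReal_one, Pi.one_apply]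
  have hS : MeasurableSet {z | x ≤ turnScore halts z} :=
    measurableSet_le measurable_const (measurable_turnScore hh)
  have h6 : turnMeasure {z | x ≤ turnScore halts z}
      = ENNReal.ofReal (Real.exp κ * (1 - κ)) := by
    rw [← lintegral_indicator_one hS]
    have : ∫⁻ z, f (turnScore halts z) ∂turnMeasure
        = ∫⁻ z, {z | x ≤ turnScore halts z}.indicator 1 z ∂turnMeasure := rfl
    rw [← this, h3, thresholdValue, if_pos hκ0.le]
    simp
  have h7 : {z | turnScore halts z < x} = {z | x ≤ turnScore halts z}ᶜ := by
    ext z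
    simp
  rw [h7, prob_compl_eq_one_sub hS, h6, ← ENNReal.ofReal_one, ← ENNReal.ofReal_sub]
  · congr 1
    unfold p
    ring
  · exact mul_nonneg (Real.exp_pos _).le (by linarith [hG.mem.2])
end

theorem threshold_unique {halts : Rule} (hh : halts.IsMeasurable)
    (hopt : ∫⁻ z, ENNReal.ofReal (G (turnScore halts z)) ∂turnMeasure
      = ENNReal.ofReal (thresholdValue G κ 0)) {κ' : ℝ} (hκ' : κ' ∈ Icc (0 : ℝ) 1)
    (hhalts : ∀ k v, halts k v ↔ κ' < ∑ j, (v j : ℝ)) : κ' = κ := by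
  have hpos : ∀ a b : ℝ, 0 ≤ a → b ≤ 1 → a < b → ¬ ∀ᵐ z ∂turnMeasure, (z 0 : ℝ) ∉ Ioo a b := by
    intro a b ha hb hab h
    have hmp := measurePreserving_eval_infinitePi
      (fun _ : ℕ => (volume : Measure unitInterval)) 0
    have hs : MeasurableSet {u : unitInterval | (u : ℝ) ∈ Ioo a b} :=
      measurable_subtype_coe measurableSet_Ioo
    have h1 : turnMeasure {z | (z 0 : ℝ) ∈ Ioo a b} = 0 := by
      simpa only [ae_iff, not_not] using h
    have h2 := hmp.measure_preimage hs.nullMeasurableSet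
    have h3 : volume {u : unitInterval | (u : ℝ) ∈ Ioo a b} = 0 := h2 ▸ h1
    have h4 : (↑) '' {u : unitInterval | (u : ℝ) ∈ Ioo a b} = Ioo a b := by
      ext x
      constructor
      · rintro ⟨u, hu, rfl⟩
        exact hu
      · exact fun hx => ⟨⟨x, ha.trans hx.1.le, hx.2.le.trans hb⟩, hx, rfl⟩
    rw [unitInterval.volume_apply, h4, Real.volume_Ioo] at h3
    exact absurd (ENNReal.ofReal_eq_zero.1 h3) (by linarith)
  have htot : ∀ (z : ℕ → unitInterval) k, halts k (fun l => z l) ↔ κ' < total z k := fun z k => by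
    rw [hhalts, total, ← Fin.sum_univ_eq_sum_range (fun j => (z j : ℝ))]
  have hin : ∀ z, z ∈ stillIn halts 1 := by
    intro z j hj
    obtain rfl : j = 0 := by omega
    rw [htot, total_zero]
    exact ⟨zero_le_one, not_lt.2 hκ'.1⟩
  have htot1 : ∀ z : ℕ → unitInterval, total z 1 = z 0 := fun z => by simp [total_succ]
  -- With positive probability the first spin falls strictly between `κ'` and `κ`; the rule then
  -- stops too early or plays on too long.
  rcases lt_trichotomy κ' κ with hlt | heq | hgt
  · refine absurd ?_ (hpos κ' κ hκ'.1 hG.mem.2.le hlt)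
    filter_upwards [hG.ae_lt_of_stopsAt hh hopt 1] with z hz hz0
    have := hz ⟨hin z, by rw [htot1]; exact (z 0).2.2, by rw [htot, htot1]; exact hz0.1⟩
    rw [htot1] at this
    exact lt_asymm this hz0.2
  · exact heq
  · refine absurd ?_ (hpos κ κ' hG.mem.1 hκ'.2 hgt)
    filter_upwards [hG.ae_le_of_stillIn hh hopt 1] with z hz hz0
    have h1 : z ∈ stillIn halts 2 := by
      rw [stillIn_succ]
      exact ⟨hin z, by rw [htot1]; exact (z 0).2.2,
        by rw [htot, htot1]; exact not_lt.2 hz0.2.le⟩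
    have := hz h1
    rw [htot1] at this
    exact not_lt.2 this hz0.1

end IsThresholdPayoff

/-! ### Histories, maximum scores and the course of the game. -/

theorem Strategy.isMeasurable_halts {i : ℕ} (τ : Strategy i) (h : Fin i → ℝ) :
    Rule.IsMeasurable (τ.halts h) := fun k =>
  measurable_prodMk_left (x := h) (τ.measurable_halts k)

theorem history_eq_iff {s s' : ℕ → ℝ} {i : ℕ} :
    history s' i = history s i ↔ ∀ j < i, s' j = s j :=
  ⟨fun h j hj => congrFun h ⟨j, hj⟩, fun h => funext fun j => h j j.2⟩

theorem ValidScores.update {i : ℕ} {s : ℕ → ℝ} (hs : ValidScores i s) {y : ℝ}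
    (hy : y ∈ Icc (0 : ℝ) 1) : ValidScores (i + 1) (Function.update s i y) := by
  intro j hj
  rcases Nat.lt_succ_iff_lt_or_eq.1 hj with h | rfl
  · rw [Function.update_of_ne h.ne]
    exact hs j h
  · rwa [Function.update_self]

theorem ValidScores.maxScore_nonneg {i : ℕ} {s : ℕ → ℝ} (hs : ValidScores i s) :
    0 ≤ maxScore (history s i) := Real.iSup_nonneg fun j => (hs j j.2).1

theorem ValidScores.maxScore_le_one {i : ℕ} {s : ℕ → ℝ} (hs : ValidScores i s) :
    maxScore (history s i) ≤ 1 := Real.iSup_le (fun j => (hs j j.2).2) zero_le_one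

theorem le_maxScore (s : ℕ → ℝ) {i j : ℕ} (hj : j < i) : s j ≤ maxScore (history s i) :=
  le_ciSup (Set.finite_range (history s i)).bddAbove ⟨j, hj⟩

theorem maxScore_lt_iff {s : ℕ → ℝ} {i : ℕ} {y : ℝ} (hy : 0 < y) :
    maxScore (history s i) < y ↔ ∀ j < i, s j < y := by
  refine ⟨fun h j hj => (le_maxScore s hj).trans_lt h, fun h => ?_⟩
  rcases i.eq_zero_or_pos with rfl | hi
  · rwa [maxScore, Real.iSup_of_isEmpty]
  · have : Nonempty (Fin i) := ⟨⟨0, hi⟩⟩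
    obtain ⟨j, hj⟩ := exists_eq_ciSup_of_finite (f := history s i)
    rw [maxScore, ← hj]
    exact h j j.2

theorem maxScore_history_update (s : ℕ → ℝ) (i : ℕ) {y : ℝ} (hy : 0 ≤ y) :
    maxScore (history (Function.update s i y) (i + 1)) = max (maxScore (history s i)) y := by
  refine le_antisymm (Real.iSup_le (fun j => ?_) (hy.trans (le_max_right _ _))) (max_le ?_ ?_)
  · rcases Nat.lt_succ_iff_lt_or_eq.1 j.2 with h | h
    · rw [history, Function.update_of_ne h.ne]
      exact (le_maxScore s h).trans (le_max_left _ _)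
    · rw [history, h, Function.update_self]
      exact le_max_right _ _
  · refine Real.iSup_le (fun j => ?_) ?_
    · have := le_maxScore (Function.update s i y) (show (j : ℕ) < i + 1 by omega)
      rwa [Function.update_of_ne j.2.ne] at this
    · have := le_maxScore (Function.update s i y) (Nat.lt_succ_self i)
      rw [Function.update_self] at this
      exact hy.trans this
  · have := le_maxScore (Function.update s i y) (Nat.lt_succ_self i)
    rwa [Function.update_self] at this

theorem play_succ (σ : Profile) (ω : ℕ → ℕ → unitInterval) (m i : ℕ) (s : ℕ → ℝ) :
    play σ ω (m + 1) i s = play σ ω m (i + 1)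
      (Function.update s i (turnScore ((σ i).halts (history s i)) (ω i))) := rfl

theorem play_apply_of_lt (σ : Profile) (ω : ℕ → ℕ → unitInterval) (m : ℕ) {i j : ℕ}
    (hj : j < i) (s : ℕ → ℝ) : play σ ω m i s j = s j := by
  induction m generalizing i s with
  | zero => rfl
  | succ m ih => rw [play_succ, ih (by omega), Function.update_of_ne hj.ne]

theorem play_update_spins (σ : Profile) (ω : ℕ → ℕ → unitInterval) (m : ℕ) {i j : ℕ}
    (hj : j < i) (z : ℕ → unitInterval) (s : ℕ → ℝ) :
    play σ (Function.update ω j z) m i s = play σ ω m i s := by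
  induction m generalizing i s with
  | zero => rfl
  | succ m ih => rw [play_succ, play_succ, ih (by omega), Function.update_of_ne hj.ne']

theorem play_update_profile (σ : Profile) (ω : ℕ → ℕ → unitInterval) (m : ℕ) {i j : ℕ}
    (hj : j < i) (τ : Strategy j) (s : ℕ → ℝ) :
    play (Function.update σ j τ) ω m i s = play σ ω m i s := by
  induction m generalizing i s with
  | zero => rfl
  | succ m ih => rw [play_succ, play_succ, ih (by omega), Function.update_of_ne hj.ne']

theorem measurable_play (σ : Profile) (m i : ℕ) :
    Measurable fun q : (ℕ → ℝ) × (ℕ → ℕ → unitInterval) => play σ q.2 m i q.1 := by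
  induction m generalizing i with
  | zero => exact measurable_fst
  | succ m ih =>
    simp only [play_succ]
    have h1 : Measurable fun q : (ℕ → ℝ) × (ℕ → ℕ → unitInterval) =>
        turnScore ((σ i).halts (history q.1 i)) (q.2 i) := by
      have h2 : Measurable fun q : (ℕ → ℝ) × (ℕ → ℕ → unitInterval) => (history q.1 i, q.2 i) := by
        refine Measurable.prodMk (measurable_pi_lambda _ fun j => ?_) (by fun_prop)
        exact (measurable_pi_apply (j : ℕ)).comp measurable_fst
      exact (measurable_turnScore_joint (σ i).measurable_halts).comp h2
    have h3 : Measurable fun q : (ℕ → ℝ) × (ℕ → ℕ → unitInterval) =>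
        Function.update q.1 i (turnScore ((σ i).halts (history q.1 i)) (q.2 i)) :=
      measurable_update'.comp (measurable_fst.prodMk h1)
    exact (ih (i + 1)).comp (h3.prodMk measurable_snd)

/-- The turn of the next player is independent of what happens afterwards, given his score. -/
theorem spinMeasure_play_succ (σ : Profile) (m i : ℕ) (s : ℕ → ℝ) {E : Set (ℕ → ℝ)}
    (hE : MeasurableSet E) :
    spinMeasure {ω | play σ ω (m + 1) i s ∈ E}
      = ∫⁻ z, spinMeasure {ω | play σ ω m (i + 1)
          (Function.update s i (turnScore ((σ i).halts (history s i)) z)) ∈ E} ∂turnMeasure := by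
  have hm : ∀ m i s, MeasurableSet {ω | play σ ω m i s ∈ E} := fun m i s =>
    ((measurable_play σ m i).comp (measurable_prodMk_left (x := s))) hE
  rw [← lintegral_indicator_one (hm _ _ _)]
  have h := lintegral_infinitePi_update (fun _ : ℕ => turnMeasure) i
    ((measurable_one (α := ENNReal)).indicator (hm (m + 1) i s))
  refine h.trans (lintegral_congr fun z => ?_)
  rw [← lintegral_indicator_one (hm _ _ _)]
  refine lintegral_congr fun ω => indicator_eq_indicator ?_ rfl
  rw [mem_ofPred_eq, mem_ofPred_eq, play_succ, play_update_spins _ _ _ (Nat.lt_succ_self i),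
    Function.update_self]

theorem measurableSet_wins (n i : ℕ) : MeasurableSet {s : ℕ → ℝ | Wins n i s} := by
  have h : {s : ℕ → ℝ | Wins n i s}
      = {s | 0 < s i} ∩ ⋂ j, ⋂ (_ : j < n), ⋂ (_ : j ≠ i), {s | s j < s i} := by
    ext s
    simp [Wins]
  rw [h]
  refine MeasurableSet.inter (measurableSet_lt (by fun_prop) (by fun_prop)) ?_
  exact MeasurableSet.iInter fun j => MeasurableSet.iInter fun _ => MeasurableSet.iInter fun _ =>
    measurableSet_lt (by fun_prop) (by fun_prop)

theorem measurableSet_scores_lt (k n : ℕ) (x : ℝ) :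
    MeasurableSet {s : ℕ → ℝ | ∀ j, k ≤ j → j < n → s j < x} := by
  have h : {s : ℕ → ℝ | ∀ j, k ≤ j → j < n → s j < x}
      = ⋂ j, ⋂ (_ : k ≤ j), ⋂ (_ : j < n), {s | s j < x} := by
    ext s
    simp
  rw [h]
  exact MeasurableSet.iInter fun j => MeasurableSet.iInter fun _ => MeasurableSet.iInter fun _ =>
    measurableSet_lt (by fun_prop) measurable_const

/-! ### The backward induction. -/

/-- From player `k` on, every player plays optimally whatever happens after the scores `s`. -/
def OptimalFrom (n : ℕ) (σ : Profile) (k : ℕ) (s : ℕ → ℝ) : Prop :=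
  ∀ l, k ≤ l → l < n → ∀ s' : ℕ → ℝ, history s' k = history s k → ValidScores l s' →
    OptimalAt n σ l s'

theorem OptimalFrom.laterOptimal {n k : ℕ} {σ : Profile} {s : ℕ → ℝ} (h : OptimalFrom n σ k s) :
    LaterOptimal n σ k s := fun l hl => h l hl.le

theorem LaterOptimal.optimalFrom_update {n i : ℕ} {σ : Profile} {s : ℕ → ℝ}
    (h : LaterOptimal n σ i s) (y : ℝ) : OptimalFrom n σ (i + 1) (Function.update s i y) := by
  intro l hl hln s' hs' hv
  refine h l hl hln s' ?_ hv
  rw [history_eq_iff] at hs' ⊢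
  intro j hj
  rw [hs' j (by omega), Function.update_of_ne hj.ne]

/-- The conclusion of the backward induction: after the best score `x > 0`, the `r` remaining
players all fail with probability `failProb θ r x`. -/
def AllFail (θ : ℕ → ℝ) (r : ℕ) (σ : Profile) : Prop :=
  ∀ (k : ℕ) (s : ℕ → ℝ), ValidScores k s → OptimalFrom (k + r) σ k s →
    0 < maxScore (history s k) →
    spinMeasure {ω | ∀ j, k ≤ j → j < k + r → play σ ω r k s j < maxScore (history s k)}
      = ENNReal.ofReal (failProb θ r (maxScore (history s k)))

section
variable {θ : ℕ → ℝ} {r i : ℕ} {σ : Profile} {s : ℕ → ℝ} (hfail : AllFail θ r σ)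
  (hs : ValidScores i s) (hσ : LaterOptimal (i + (r + 1)) σ i s)
include hfail hs hσ

/-- Condition on the score `y` of the turn: it must beat the earlier maximum, and then becomes the
positive maximum to which `AllFail` applies. This reduces the game to a single turn. -/
theorem winProb_update (τ : Strategy i) :
    winProb (i + (r + 1)) (Function.update σ i τ) i s
      = ∫⁻ z, ENNReal.ofReal (payoff θ r (maxScore (history s i))
          (turnScore (τ.halts (history s i)) z)) ∂turnMeasure := by
  rw [winProb, Nat.add_sub_cancel_left]
  refine (spinMeasure_play_succ _ r i s (measurableSet_wins _ _)).trans
    (lintegral_congr fun z => ?_)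
  rw [Function.update_self]
  set y := turnScore (τ.halts (history s i)) z with hy
  have hyI : y ∈ Icc (0 : ℝ) 1 := turnScore_mem_Icc _ _
  have hm0 := hs.maxScore_nonneg
  have hplay : ∀ ω, play (Function.update σ i τ) ω r (i + 1) (Function.update s i y)
      = play σ ω r (i + 1) (Function.update s i y) := fun ω =>
    play_update_profile σ ω r (Nat.lt_succ_self i) τ _
  have hlow : ∀ ω, ∀ j < i, play σ ω r (i + 1) (Function.update s i y) j = s j := fun ω j hj => by
    rw [play_apply_of_lt _ _ _ (by omega), Function.update_of_ne hj.ne]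
  have hself : ∀ ω, play σ ω r (i + 1) (Function.update s i y) i = y := fun ω => by
    rw [play_apply_of_lt _ _ _ (by omega), Function.update_self]
  by_cases hlt : maxScore (history s i) < y
  · have hy0 : 0 < y := hm0.trans_lt hlt
    have hmax : maxScore (history (Function.update s i y) (i + 1)) = y := by
      rw [maxScore_history_update s i hyI.1, max_eq_right hlt.le]
    have h := hfail (i + 1) (Function.update s i y) (hs.update hyI)
      (by
        rw [show i + 1 + r = i + (r + 1) by omega]
        exact hσ.optimalFrom_update y) (by rwa [hmax])
    rw [hmax] at h
    rw [payoff, if_pos hlt, ← h]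
    congr 1
    ext ω
    rw [mem_ofPred_eq, mem_ofPred_eq, hplay, mem_ofPred_eq, Wins, hself]
    constructor
    · exact fun hw j hj hjn => hw.2 j (by omega) (by omega)
    · refine fun hw => ⟨hy0, fun j hj hji => ?_⟩
      rcases lt_or_gt_of_ne hji with h1 | h1
      · rw [hlow ω j h1]
        exact (maxScore_lt_iff hy0).1 hlt j h1
      · exact hw j h1 (by omega)
  · rw [payoff, if_neg hlt, ENNReal.ofReal_zero]
    convert measure_empty (μ := spinMeasure)
    rw [eq_empty_iff_forall_notMem]
    intro ω hw
    rw [mem_ofPred_eq, hplay, mem_ofPred_eq, Wins, hself] at hw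
    refine hlt ((maxScore_lt_iff hw.1).2 fun j hj => ?_)
    have := hw.2 j (by omega) hj.ne
    rwa [hlow ω j hj] at this

variable (hθ : ∀ r, 1 ≤ r → IsGreedRoot r (θ r))
include hθ

/-- The threshold rule attains the upper bound, so optimality means attaining it. -/
theorem optimalAt_update_iff (hm : maxScore (history s i) < 1) (τ : Strategy i) :
    OptimalAt (i + (r + 1)) (Function.update σ i τ) i s ↔
      ∫⁻ z, ENNReal.ofReal (payoff θ r (maxScore (history s i))
          (turnScore (τ.halts (history s i)) z)) ∂turnMeasure
        = ENNReal.ofReal (thresholdValue (payoff θ r (maxScore (history s i)))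
            (max (θ (r + 1)) (maxScore (history s i))) 0) := by
  have hG := isThresholdPayoff hθ r hs.maxScore_nonneg hm
  have hle : ∀ τ : Strategy i, _ := fun τ =>
    hG.lintegral_turnScore_le (τ.isMeasurable_halts (history s i))
  simp only [OptimalAt, Function.update_idem, winProb_update hfail hs hσ]
  constructor
  · intro h
    refine le_antisymm (hle τ) ?_
    have h1 := h (Strategy.threshold (fun _ => max (θ (r + 1)) (maxScore (history s i)))
      measurable_const)
    rwa [hG.lintegral_turnScore_threshold (Strategy.isMeasurable_halts _ _)
      fun _ _ => Iff.rfl] at h1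
  · intro h τ'
    rw [h]
    exact hle τ'

theorem isOptimalThreshold_max :
    IsOptimalThreshold (i + (r + 1)) σ i s (max (θ (r + 1)) (maxScore (history s i))) := by
  rcases hs.maxScore_le_one.lt_or_eq with hm | hm
  · exact (optimalAt_update_iff hfail hs hσ hθ hm _).2
      ((isThresholdPayoff hθ r hs.maxScore_nonneg hm).lintegral_turnScore_threshold
        (Strategy.isMeasurable_halts _ _) fun _ _ => Iff.rfl)
  -- A maximum of `1` cannot be beaten, so every strategy wins with probability `0`.
  · intro τ
    rw [Function.update_idem, winProb_update hfail hs hσ]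
    refine le_of_eq_of_le ?_ zero_le
    simp only [payoff, hm, if_neg (not_lt.2 (turnScore_mem_Icc _ _).2), ENNReal.ofReal_zero,
      lintegral_zero]

theorem IsOptimalThreshold.eq_max (hm : maxScore (history s i) < 1) {κ : ℝ}
    (hκ : κ ∈ Icc (0 : ℝ) 1) (h : IsOptimalThreshold (i + (r + 1)) σ i s κ) :
    κ = max (θ (r + 1)) (maxScore (history s i)) :=
  (isThresholdPayoff hθ r hs.maxScore_nonneg hm).threshold_unique
    (Strategy.isMeasurable_halts _ _) ((optimalAt_update_iff hfail hs hσ hθ hm _).1 h) hκ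
    fun _ _ => Iff.rfl

theorem measure_turnScore_lt_maxScore (hopt : OptimalAt (i + (r + 1)) σ i s)
    (hpos : 0 < maxScore (history s i)) :
    turnMeasure {z | turnScore ((σ i).halts (history s i)) z < maxScore (history s i)}
      = ENNReal.ofReal (p (max (θ (r + 1)) (maxScore (history s i)))) := by
  rcases hs.maxScore_le_one.lt_or_eq with hm | hm
  · refine (isThresholdPayoff hθ r hs.maxScore_nonneg hm).measure_turnScore_lt
      ((σ i).isMeasurable_halts _) ?_ hpos (le_max_right _ _)
    refine (optimalAt_update_iff hfail hs hσ hθ hm (σ i)).1 ?_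
    rwa [Function.update_eq_self]
  -- Here optimality says nothing, but any strategy reaches the score `1` with probability `0`.
  · rw [hm, max_eq_right (hθ (r + 1) (by omega)).lt_one.le, p_at_one, ENNReal.ofReal_one,
      ← prob_compl_eq_zero_iff (measurableSet_lt
        (measurable_turnScore ((σ i).isMeasurable_halts _)) measurable_const)]
    refine measure_mono_null (fun z hz => ?_) (measure_turnScore_eq
      (halts := (σ i).halts (history s i)) one_pos)
    exact le_antisymm (turnScore_mem_Icc _ _).2 (not_lt.1 hz)
end

/-- If the next player stays below the maximum `x`, it is still `x` for the players after him, so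
his factor `p (max (θ (r + 1)) x)` multiplies `failProb θ r x`. -/
theorem allFail {θ : ℕ → ℝ} (hθ : ∀ r, 1 ≤ r → IsGreedRoot r (θ r)) (σ : Profile) (r : ℕ) :
    AllFail θ r σ := by
  induction r with
  | zero =>
    intro k s _ _ _
    have h : {ω : ℕ → ℕ → unitInterval | ∀ j, k ≤ j → j < k + 0 →
        play σ ω 0 k s j < maxScore (history s k)} = univ :=
      eq_univ_of_forall fun ω j hj hj' => by omega
    rw [h, measure_univ, failProb, Finset.prod_range_zero, ENNReal.ofReal_one]
  | succ r ih =>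
    intro k s hs hσ hpos
    set x := maxScore (history s k) with hx
    have hT := measure_turnScore_lt_maxScore ih hs hσ.laterOptimal hθ
      (hσ k le_rfl (by omega) s rfl hs) hpos
    have hS : MeasurableSet {z | turnScore ((σ k).halts (history s k)) z < x} :=
      measurableSet_lt (measurable_turnScore ((σ k).isMeasurable_halts _)) measurable_const
    have h := spinMeasure_play_succ σ r k s (measurableSet_scores_lt k (k + (r + 1)) x)
    refine h.trans ?_
    have hprod : failProb θ (r + 1) x = failProb θ r x * p (max (θ (r + 1)) x) :=
      Finset.prod_range_succ _ _
    rw [hprod, ENNReal.ofReal_mul (failProb_nonneg hθ r x), ← hT,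
      ← lintegral_indicator_const hS]
    refine lintegral_congr fun z => ?_
    set y := turnScore ((σ k).halts (history s k)) z with hy
    have hyI : y ∈ Icc (0 : ℝ) 1 := turnScore_mem_Icc _ _
    have hself : ∀ ω, play σ ω r (k + 1) (Function.update s k y) k = y := fun ω => by
      rw [play_apply_of_lt _ _ _ (by omega), Function.update_self]
    by_cases hlt : y < x
    · rw [indicator_of_mem (show z ∈ {z | turnScore ((σ k).halts (history s k)) z < x} from hlt)]
      have hmax : maxScore (history (Function.update s k y) (k + 1)) = x := by
        rw [maxScore_history_update s k hyI.1, max_eq_left hlt.le]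
      have h1 := ih (k + 1) (Function.update s k y) (hs.update hyI)
        (by
          rw [show k + 1 + r = k + (r + 1) by omega]
          exact hσ.laterOptimal.optimalFrom_update y) (by rwa [hmax])
      rw [hmax] at h1
      refine Eq.trans ?_ h1
      congr 1
      ext ω
      simp only [mem_ofPred_eq]
      constructor
      · exact fun hw j hj hjn => hw j (by omega) (by omega)
      · intro hw j hj hjn
        rcases hj.eq_or_lt with rfl | h2
        · rwa [hself]
        · exact hw j h2 (by omega)
    · rw [indicator_of_notMem (show z ∉ {z | turnScore ((σ k).halts (history s k)) z < x} from hlt)]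
      convert measure_empty (μ := spinMeasure)
      rw [eq_empty_iff_forall_notMem]
      intro ω hw
      have := hw k le_rfl (by omega)
      rw [hself] at this
      exact hlt this

/-! ### The profile of all optimal thresholds. -/

theorem winProb_update_of_halts_eq (n : ℕ) (σ : Profile) (i : ℕ) (s : ℕ → ℝ) {τ : Strategy i}
    (h : τ.halts (history s i) = (σ i).halts (history s i)) :
    winProb n (Function.update σ i τ) i s = winProb n σ i s := by
  unfold winProb
  congr 1
  ext ω
  rw [mem_ofPred_eq, mem_ofPred_eq]
  cases n - i with
  | zero => rfl
  | succ m =>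
    rw [play_succ, play_succ, play_update_profile _ _ _ (Nat.lt_succ_self i),
      Function.update_self, h]

/-- Optimality after `s` sees the player's strategy only at that history, so a constant threshold
may replace one that depends on the scores. -/
theorem OptimalAt.of_update {n : ℕ} {σ : Profile} {i : ℕ} {s : ℕ → ℝ} {τ : Strategy i}
    (hopt : OptimalAt n (Function.update σ i τ) i s)
    (h : τ.halts (history s i) = (σ i).halts (history s i)) : OptimalAt n σ i s := by
  intro τ'
  have := hopt τ'
  rwa [Function.update_idem, winProb_update_of_halts_eq n σ i s h] at this

theorem optimalAt_thresholdProfile {θ : ℕ → ℝ} (hθ : ∀ r, 1 ≤ r → IsGreedRoot r (θ r)) (n r : ℕ) :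
    ∀ (i : ℕ) (s : ℕ → ℝ), i + (r + 1) = n → ValidScores i s →
      OptimalAt n (thresholdProfile n θ) i s := by
  induction r using Nat.strong_induction_on with
  | _ r ih =>
    rintro i s rfl hs
    -- Player `k` has `i + r - k < r` players after him, so strong induction supplies the optimality
    -- of all later players.
    have hσ : LaterOptimal (i + (r + 1)) (thresholdProfile (i + (r + 1)) θ) i s :=
      fun k hik hkn s' _ hs' => ih (i + r - k) (by omega) k s' (by omega) hs'
    refine (isOptimalThreshold_max (allFail hθ _ r) hs hσ hθ).of_update ?_
    simp only [thresholdProfile, Strategy.threshold, Nat.add_sub_cancel_left]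

end Showcase

end
open Showcase in
theorem proposition5p3 :
    (∀ r : ℕ, 1 ≤ r → ∃! x : ℝ, IsGreedRoot r x) ∧
    ∀ θ : ℕ → ℝ, (∀ r : ℕ, 1 ≤ r → IsGreedRoot r (θ r)) →
      -- `i` players have already played, with scores `s`, and `r` players are still to play
      (∀ (i r : ℕ) (s : ℕ → ℝ), 1 ≤ r → ValidScores i s →
        ∀ σ : Profile, LaterOptimal (i + r) σ i s →
          IsOptimalThreshold (i + r) σ i s (max (θ r) (maxScore (history s i))) ∧
          (maxScore (history s i) < 1 → ∀ κ : ℝ, κ ∈ Set.Icc (0 : ℝ) 1 →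
            IsOptimalThreshold (i + r) σ i s κ → κ = max (θ r) (maxScore (history s i)))) ∧
      -- if all the players use these thresholds, each of them plays optimally at every stage
      (∀ (n i : ℕ) (s : ℕ → ℝ), i < n → ValidScores i s →
        OptimalAt n (thresholdProfile n θ) i s) := by
  refine ⟨fun r _ => existsUnique_isGreedRoot r, fun θ hθ => ⟨?_, ?_⟩⟩
  · intro i r s hr hs σ hσ
    obtain ⟨q, rfl⟩ : ∃ q, r = q + 1 := ⟨r - 1, by omega⟩
    exact ⟨isOptimalThreshold_max (allFail hθ σ q) hs hσ hθ, fun hm κ hκ h =>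
      IsOptimalThreshold.eq_max (allFail hθ σ q) hs hσ hθ hm hκ h⟩
  · exact fun n i s hi hs => optimalAt_thresholdProfile hθ n (n - i - 1) i s (by omega) hs
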